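/- Let $\Bbbk$ be an algebraically closed field of characteristic zero, let $t,a,b,k,p,q\in\Bbbk$ with $t\neq 0$, and let $V$ be the vector space with basis $x_1,x_2,x_3$ and braiding $c$ of type $\mathfrak R_{1,6}$, given by (writing $x_ix_j$ for $x_i\otimes x_j$) $$\begin{aligned} c(x_1x_1)&=t\,x_1x_1, & c(x_2x_1)&=t\,(x_1x_2+a\,x_1x_1), & c(x_3x_1)&=t\,(x_1x_3+p\,x_1x_1),\\ c(x_1x_2)&=t\,(x_2x_1-a\,x_1x_1), & c(x_1x_3)&=t\,(x_3x_1-p\,x_1x_1), && \end{aligned}$$ $$\begin{aligned} c(x_2x_2)&=t\,(x_2x_2+b\,x_2x_1-b\,x_1x_2-ab\,x_1x_1),\\ c(x_3x_2)&=t\,(x_2x_3+p\,x_2x_1-a\,x_1x_3-(2pa+k)\,x_1x_1),\\ c(x_2x_3)&=t\,(x_3x_2+a\,x_3x_1-p\,x_1x_2+k\,x_1x_1),\\ c(x_3x_3)&=t\,(x_3x_3+q\,x_3x_1-q\,x_1x_3-pq\,x_1x_1). \end{aligned}$$ Let $\mathcal J(V)=\bigoplus_{n\ge 2}\mathcal J_n(V)\subset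 T(V)$, where $\mathcal J_n(V)\subset V^{\otimes n}$ is the kernel of the quantum symmetrizer $Q_n=\sum_{\sigma\in\mathbb S_n}\rho_n(M(\sigma))$; here $\rho_n$ is the representation of the braid group $\mathbb B_n$ on $V^{\otimes n}$ induced by $c$ and $M:\mathbb S_n\to\mathbb B_n$ is the Matsumoto section. Let $\mathfrak B(V)=T(V)/\mathcal J(V)$ be the Nichols algebra of $(V,c)$. 1. If $t^2\neq 1$, then $\mathfrak B(V)$ has no quadratic relations, i.e. $\mathcal J_2(V)=0$. 2. If $t=-1$, then $\mathcal J(V)$ is the two-sided ideal of $T(V)$ generated by $$x_2x_1+x_1x_2,\quad x_3x_1+x_1x_3,\quad x_3x_2+x_2x_3-a\,x_1x_3-p\,x_1x_2,\quad x_1^2,\quad x_2^2-b\,x_1x_2,\quad x_3^2-q\,x_1x_3;$$ the set $B_0=\{x_1^{a_1}x_2^{a_2}x_3^{a_3}: 0\le a_i<2\}$ is a basis of $\mathfrak B(V)$; $\dim\mathfrak B(V)=8$ and $\operatorname{GKdim}\mathfrak B(V)=0$. 3. If $t=1$, then $\mathcal J(V)$ is the two-sided ideal of $T(V)$ generated by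 $$x_2x_1-x_1x_2-a\,x_1^2,\quad x_3x_1-x_1x_3-p\,x_1^2,\quad x_3x_2-x_2x_3+a\,x_1x_3-p\,x_1x_2+(k+pa)\,x_1^2;$$ the set $B_3=\{x_1^{a_1}x_2^{a_2}x_3^{a_3}: a_i\ge 0\}$ is a (PBW) basis of $\mathfrak B(V)$ and $\operatorname{GKdim}\mathfrak B(V)=3$. -/

import Mathlib

open Module Filter

noncomputable section

namespace NicholsR16

/-! ### Matsumoto section of the symmetric group

Reduced expressions in the adjacent transpositions `s_i = (i  i+1)`, with positions counted from `0`. -/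

/-- The adjacent transposition `s_i` of `Fin n` (the identity if `i + 1` is out of range). -/
def adjSwap (n i : ℕ) : Equiv.Perm (Fin n) :=
  if h : i + 1 < n then Equiv.swap ⟨i, by omega⟩ ⟨i + 1, h⟩ else 1

/-- The permutation `τ` with `σ = s_{m-1} ⋯ s_0 (1 × τ)`, `m = σ 0`. -/
def tailPerm {n : ℕ} (σ : Equiv.Perm (Fin (n+1))) : Equiv.Perm (Fin n) :=
  (Equiv.Perm.decomposeFin (Fin.cycleRange (σ 0) * σ)).2

/-- A reduced word of `σ`: write `σ = s_{m-1} ⋯ s_1 s_0 (1 × τ)`, where `m = σ 0` and `1 × τ` fixes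
`0` and acts as `τ` on the remaining points; then continue with `τ`. -/
def reducedWord : (n : ℕ) → Equiv.Perm (Fin n) → List ℕ
  | 0, _ => []
  | n + 1, σ =>
      (List.range (σ 0 : ℕ)).reverse ++
        (reducedWord n (tailPerm σ)).map (· + 1)

/-- The number of inversions of `σ`, i.e. its Coxeter length. -/
def inversions {n : ℕ} (σ : Equiv.Perm (Fin n)) : ℕ :=
  (Finset.univ.filter fun x : Fin n × Fin n => x.1 < x.2 ∧ σ x.2 < σ x.1).card

theorem cycleRange_mul_eq {n : ℕ} (σ : Equiv.Perm (Fin (n+1))) :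
    Fin.cycleRange (σ 0) * σ = Equiv.Perm.decomposeFin.symm (0, tailPerm σ) := by
  set ρ := Fin.cycleRange (σ 0) * σ with hρ
  have h0 : ρ 0 = 0 := by simp [hρ]
  obtain ⟨⟨p, e⟩, hpe⟩ := Equiv.Perm.decomposeFin.symm.surjective ρ
  have hp : p = 0 := by
    rw [← hpe] at h0
    simpa using h0
  subst hp
  have : tailPerm σ = e := by
    unfold tailPerm
    rw [← hρ, ← hpe, Equiv.apply_symm_apply]
  rw [this, hpe]

theorem apply_succ {n : ℕ} (σ : Equiv.Perm (Fin (n+1))) (j : Fin n) :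
    σ j.succ = (σ 0).succAbove (tailPerm σ j) := by
  have h := congrArg (fun ρ : Equiv.Perm (Fin (n+1)) => ρ j.succ) (cycleRange_mul_eq σ)
  simp only [Equiv.Perm.mul_apply, Equiv.Perm.decomposeFin_symm_apply_succ, Equiv.swap_self,
    Equiv.refl_apply] at h
  rw [← Fin.cycleRange_symm_succ, ← h, Equiv.symm_apply_apply]

theorem prod_range_adjSwap (n m : ℕ) (hm : m < n + 1) :
    (((List.range m).reverse).map (adjSwap (n+1))).prod = (Fin.cycleRange ⟨m, hm⟩)⁻¹ := by
  induction m with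
  | zero => 
    simp
  | succ m ih =>
    rw [List.range_succ, List.reverse_append, List.reverse_singleton, List.singleton_append,
      List.map_cons, List.prod_cons, ih (by omega), ← inv_inj, mul_inv_rev, inv_inv, inv_inv]
    ext x
    simp only [adjSwap, hm, dif_pos, Equiv.swap_inv, Equiv.Perm.mul_apply]
    rcases lt_trichotomy x.val (m+1) with h | h | h
    · rw [Fin.coe_cycleRange_of_lt (i := x) (j := ⟨m+1,hm⟩) h]
      rcases Nat.lt_or_ge x.val m with h' | h'
      · rw [Equiv.swap_apply_of_ne_of_ne, Fin.coe_cycleRange_of_lt (by exact h')] <;>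
          simp [Fin.ext_iff] <;> omega
      · obtain rfl : m = x.val := by omega
        rw [show (⟨x.val, by omega⟩ : Fin (n + 1)) = x from rfl]
        rw [Equiv.swap_apply_left, Fin.cycleRange_of_gt (by simp [Fin.lt_def])]
    · have : x = ⟨m+1, hm⟩ := Fin.ext h
      subst this
      simp
    · rw [Equiv.swap_apply_of_ne_of_ne, Fin.cycleRange_of_gt, Fin.cycleRange_of_gt] <;>
          simp [Fin.ext_iff, Fin.lt_def] <;> omega

theorem adjSwap_succ (n i : ℕ) :
    adjSwap (n+1) (i+1) = Equiv.Perm.decomposeFin.symm (0, adjSwap n i) := by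
  unfold adjSwap
  split_ifs with h1 h2 h2
  · ext x
    refine Fin.cases ?_ (fun y => ?_) x
    · simp [Equiv.swap_apply_def, Fin.ext_iff]
    · simp only [Equiv.Perm.decomposeFin_symm_apply_succ, Equiv.swap_self, Equiv.refl_apply]
      rw [(Fin.succ_injective n).map_swap]; rfl
  · omega
  · omega
  · simp; rfl

theorem decomposeFin_symm_mul {n : ℕ} (e f : Equiv.Perm (Fin n)) :
    Equiv.Perm.decomposeFin.symm ((0 : Fin (n+1)), e * f) =
      Equiv.Perm.decomposeFin.symm (0, e) * Equiv.Perm.decomposeFin.symm (0, f) := by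
  ext x
  refine Fin.cases ?_ (fun y => ?_) x <;> simp

/-- The reduced word of `σ` is an expression of `σ`. -/
theorem prod_reducedWord (n : ℕ) (σ : Equiv.Perm (Fin n)) :
    ((reducedWord n σ).map (adjSwap n)).prod = σ := by
  induction n with
  | zero => exact Subsingleton.elim _ _
  | succ n ih =>
    have key : ∀ l : List ℕ, (((l.map (· + 1)).map (adjSwap (n+1))).prod) =
        Equiv.Perm.decomposeFin.symm (0, (l.map (adjSwap n)).prod) := by
      intro l
      induction l with
      | nil => simp; rfl
      | cons i l ihl =>
        simp only [List.map_cons, List.prod_cons, decomposeFin_symm_mul, ihl, adjSwap_succ]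
    rw [reducedWord, List.map_append, List.prod_append, key, ih, prod_range_adjSwap n _ (σ 0).2]
    change _ * Equiv.Perm.decomposeFin.symm (0, tailPerm σ) = σ
    rw [← cycleRange_mul_eq, inv_mul_cancel_left]

/-- The reduced word of `σ` has minimal length: as many letters as `σ` has inversions. -/
theorem length_reducedWord (n : ℕ) (σ : Equiv.Perm (Fin n)) :
    (reducedWord n σ).length = inversions σ := by
  induction n with
  | zero => simp [reducedWord, inversions]
  | succ n ih =>
    rw [reducedWord, List.length_append, List.length_map, ih, List.length_reverse,
      List.length_range]
    have hc : ∀ p : Fin (n+1), (Finset.univ.filter fun j : Fin n => p.succAbove j < p).card = p := by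
      intro p
      have : (Finset.univ.filter fun j : Fin n => p.succAbove j < p) =
          Finset.univ.filter fun j : Fin n => j.val < p.val := by
        ext j; simp only [Finset.mem_filter, Finset.mem_univ, true_and, Fin.succAbove_lt_iff_castSucc_lt]
        rfl
      rw [this, Fin.card_filter_val_lt]; omega
    have hc' : (Finset.univ.filter fun j : Fin n => σ j.succ < σ 0).card = σ 0 := by
      rw [← hc (σ 0)]
      refine Finset.card_bij (fun j _ => tailPerm σ j) ?_ ?_ ?_
      · intro j hj; simpa [apply_succ] using hj
      · intro i _ j _ h; exact (tailPerm σ).injective h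
      · intro j hj
        exact ⟨(tailPerm σ).symm j, by simpa [apply_succ] using hj, by simp⟩
    unfold inversions
    simp only [Finset.card_filter, Fintype.sum_prod_type, Fin.sum_univ_succ] at hc' ⊢
    simp only [apply_succ, Fin.succAbove_lt_succAbove_iff] at hc' ⊢
    simp [hc']

/-! ### The Nichols algebra of a braided vector space with a basis

`V` is the vector space with basis `x_i`, `i : X`, and the tensor algebra `T(V)` is the free algebra
on the `x_i`. The braiding is given by its structure constants:
`c (x_i ⊗ x_j) = ∑_{k, l} r i j k l x_k ⊗ x_l`. -/

section Nichols

variable {K : Type*} [Field K] {X : Type*} [Fintype X]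

/-- The basis element `x_{i_1} x_{i_2} ⋯ x_{i_n}` of `T(V)`. -/
def wordMonomial (K : Type*) [Field K] {X : Type*} (w : List X) : FreeAlgebra K X :=
  (w.map (FreeAlgebra.ι K)).prod

/-- `id^{⊗ i} ⊗ c ⊗ id^{⊗ (n - i - 2)}` applied to a word of length `n`, for `i + 2 ≤ n`
(words that are too short are left alone). -/
def braidWord (r : X → X → X → X → K) : ℕ → List X → FreeAlgebra K X
  | 0, x :: y :: w =>
      ∑ k : X, ∑ l : X,
        r x y k l • (FreeAlgebra.ι K k * FreeAlgebra.ι K l * wordMonomial K w)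
  | i + 1, x :: w => FreeAlgebra.ι K x * braidWord r i w
  | _, w => wordMonomial K w

/-- The operator `id^{⊗ i} ⊗ c ⊗ id ⊗ ⋯ ⊗ id` on `T(V)`, by which the `i`-th generator of the braid
group acts. -/
def braidOp (r : X → X → X → X → K) (i : ℕ) : End K (FreeAlgebra K X) :=
  (FreeAlgebra.basisFreeMonoid K X).constr K fun w => braidWord r i w.toList

/-- The quantum symmetrizer `Q_n = ∑_{σ ∈ S_n} ρ_n (M σ)`, where `M σ` is the Matsumoto lift of `σ`
to the braid group (the product of the braid generators along a reduced word of `σ`). It is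
meant to be applied to `T^n(V)`. -/
def quantumSymmetrizer (r : X → X → X → X → K) (n : ℕ) : End K (FreeAlgebra K X) :=
  ∑ σ : Equiv.Perm (Fin n), ((reducedWord n σ).map (braidOp r)).prod

/-- `T^n(V)`, the homogeneous component of degree `n` of `T(V)`. -/
def tensorDegree (K : Type*) [Field K] (X : Type*) (n : ℕ) : Submodule K (FreeAlgebra K X) :=
  Submodule.span K {m | ∃ w : List X, w.length = n ∧ m = wordMonomial K w}

/-- `J_n(V)`, the kernel of `Q_n` on `T^n(V)`: the relations of degree `n` of the Nichols algebra. -/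
def nicholsRelations (r : X → X → X → X → K) (n : ℕ) : Submodule K (FreeAlgebra K X) :=
  tensorDegree K X n ⊓ LinearMap.ker (quantumSymmetrizer r n)

/-- `J(V) = ⨁_{n ≥ 2} J_n(V)`, as a subspace of `T(V)`. -/
def nicholsSubspace (r : X → X → X → X → K) : Submodule K (FreeAlgebra K X) :=
  ⨆ n : ℕ, ⨆ _ : 2 ≤ n, nicholsRelations r n

/-- The two-sided ideal generated by `J(V)`. When `r` is a braiding, `J(V)` is already an ideal, so
this is `J(V)` itself. -/
def nicholsIdeal (r : X → X → X → X → K) : TwoSidedIdeal (FreeAlgebra K X) :=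
  TwoSidedIdeal.span (nicholsSubspace r : Set (FreeAlgebra K X))

/-- The Nichols algebra `B(V) = T(V) / J(V)`. -/
abbrev NicholsAlgebra (r : X → X → X → X → K) : Type _ :=
  (nicholsIdeal r).ringCon.Quotient

/-- The image of the basis vector `x_i` of `V` in `B(V)`. -/
def gen (r : X → X → X → X → K) (i : X) : NicholsAlgebra r :=
  (nicholsIdeal r).ringCon.mk' (FreeAlgebra.ι K i)

end Nichols

/-- The Gelfand–Kirillov dimension of an algebra `A`: the supremum over all finite-dimensional
subspaces `W` of `limsup_n log_n dim (W^0 + W^1 + ⋯ + W^n)`. -/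
def GKdim (K A : Type*) [Field K] [Ring A] [Algebra K A] : EReal :=
  ⨆ W : {W : Submodule K A // W.FG},
    limsup (fun n : ℕ =>
      ((Real.log (finrank K (⨆ i : Fin (n + 1), W.1 ^ (i : ℕ) : Submodule K A)) / Real.log n : ℝ)
        : EReal)) atTop

/-! ### The braiding of type `R_{1,6}` -/

section R16

variable {K : Type*} [Field K]

/-- The solution `R_{1,6}` of the quantum Yang-Baxter equation. The rows are indexed by
`11, 12, 13, 21, 22, 23, 31, 32, 33` and the columns by `11, 21, 31, 12, 22, 32, 13, 23, 33`. -/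
def matrixR16 (t a b k p q : K) : Matrix (Fin (3 * 3)) (Fin (3 * 3)) K :=
  !![t, t*a, t*p, -(t*a), -(t*a*b), -(t*(2*p*a+k)), -(t*p), t*k,    -(t*p*q);
     0, t,   0,   0,      -(t*b),   0,              0,      -(t*p), 0;
     0, 0,   t,   0,      0,        -(t*a),         0,      0,      -(t*q);
     0, 0,   0,   t,      t*b,      t*p,            0,      0,      0;
     0, 0,   0,   0,      t,        0,              0,      0,      0;
     0, 0,   0,   0,      0,        t,              0,      0,      0;
     0, 0,   0,   0,      0,        0,              t,      t*a,    t*q;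
     0, 0,   0,   0,      0,        0,              0,      t,      0;
     0, 0,   0,   0,      0,        0,              0,      0,      t]

/-- The structure constants of the braiding of `R_{1,6}`: the coefficient of `x_m ⊗ x_l` in
`c (x_i ⊗ x_j)` is the entry of the matrix in row `ml` and column `ij`. -/
def braidingR16 (t a b k p q : K) (i j m l : Fin 3) : K :=
  matrixR16 t a b k p q (finProdFinEquiv (m, l)) (finProdFinEquiv (j, i))

/-- The generator `x_1` of `T(V)`. -/
def x₁ (K : Type*) [Field K] : FreeAlgebra K (Fin 3) := FreeAlgebra.ι K 0

/-- The generator `x_2` of `T(V)`. -/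
def x₂ (K : Type*) [Field K] : FreeAlgebra K (Fin 3) := FreeAlgebra.ι K 1

/-- The generator `x_3` of `T(V)`. -/
def x₃ (K : Type*) [Field K] : FreeAlgebra K (Fin 3) := FreeAlgebra.ι K 2

/-- The defining relations for `t = -1`. -/
def relationsNeg (a b p q : K) : Set (FreeAlgebra K (Fin 3)) :=
  {x₂ K * x₁ K + x₁ K * x₂ K,
   x₃ K * x₁ K + x₁ K * x₃ K,
   x₃ K * x₂ K + x₂ K * x₃ K - a • (x₁ K * x₃ K) - p • (x₁ K * x₂ K),
   x₁ K ^ 2,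
   x₂ K ^ 2 - b • (x₁ K * x₂ K),
   x₃ K ^ 2 - q • (x₁ K * x₃ K)}

/-- The defining relations for `t = 1`. -/
def relationsPos (a k p : K) : Set (FreeAlgebra K (Fin 3)) :=
  {x₂ K * x₁ K - x₁ K * x₂ K - a • x₁ K ^ 2,
   x₃ K * x₁ K - x₁ K * x₃ K - p • x₁ K ^ 2,
   x₃ K * x₂ K - x₂ K * x₃ K + a • (x₁ K * x₃ K) - p • (x₁ K * x₂ K) + (k + p * a) • x₁ K ^ 2}

end R16

end NicholsR16

end

/-! The braiding satisfies c² = t² on V ⊗ V. Since Q_2 = 1 + c, a quadratic relation v has c v = -v,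
hence t² v = v, so v = 0 unless t² = 1.

For t = ±1 the braiding is an involution, and the braid group acts on V^{⊗n} through S_n. Then Q_n
c_i = Q_n (`CoxeterRel.coxSym_mul`). If s has degree 2 and c s = -s, it follows that Q_n(u s w) =
-Q_n(u s w), so u s w is a relation. Conversely, each c_i is the identity modulo the ideal I
generated by all v - c v, so Q_n is multiplication by n! modulo I, and ker Q_n ⊆ I in characteristic
zero. Hence J(V) = I is generated in degree 2 (`nicholsSubspace_eq_span`). It remains to see that
the listed relations are (-1)-eigenvectors of c and that the ideal they generate contains every v -
c v.

The relations straighten every product into ordered monomials, which gives spanning. Independence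
comes from a representation in which the ordered monomials, applied to a single vector, give
independent vectors: on K^8 for t = -1, and on polynomials in X, Y, Z for t = 1, where the matrix is
unitriangular with respect to the X-degree. For t = 1 the ordered monomials of degree at most n span
a space whose dimension lies between (n/3)³ and (n+1)³, and this forces GKdim = 3. -/

noncomputable section

namespace NicholsR16

/-! ### Symmetrizers under the Coxeter relations -/

section CoxeterSymmetrizer

variable {R : Type*} [Ring R]

/-- The sum over the symmetric group of the products of the `s i` along reduced words. -/
def coxSym (s : ℕ → R) (n : ℕ) : R :=
  ∑ σ : Equiv.Perm (Fin n), ((reducedWord n σ).map s).prod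

/-- The descending product `s (m-1) * ⋯ * s 1 * s 0`. -/
def descProd (s : ℕ → R) (m : ℕ) : R := ((List.range m).reverse.map s).prod

@[simp] theorem descProd_zero (s : ℕ → R) : descProd s 0 = 1 := by simp [descProd]

theorem descProd_succ (s : ℕ → R) (m : ℕ) : descProd s (m + 1) = s m * descProd s m := by
  simp [descProd, List.range_succ]

theorem descProd_shift (s : ℕ → R) (m : ℕ) :
    descProd (fun i => s (i + 1)) m * s 0 = descProd s (m + 1) := by
  induction m with
  | zero => simp [descProd_succ]
  | succ m ih => rw [descProd_succ, mul_assoc, ih, ← descProd_succ]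

/-- A permutation is determined by its value at `0` and its tail. -/
def headTailEquiv (n : ℕ) : Equiv.Perm (Fin (n + 1)) ≃ Fin (n + 1) × Equiv.Perm (Fin n) :=
  Equiv.ofBijective (fun σ => (σ 0, tailPerm σ)) <| by
    rw [Fintype.bijective_iff_injective_and_card]
    refine ⟨fun σ τ h => ?_, ?_⟩
    · simp only [Prod.mk.injEq] at h
      ext x
      refine Fin.cases ?_ (fun y => ?_) x
      · rw [h.1]
      · rw [apply_succ, apply_succ, h.1, h.2]
    · simp [Fintype.card_perm, Nat.factorial_succ]

/-- The `descProd s m` stand for the minimal representatives of the left cosets of S_n, the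
stabilizer of `0`, in S_{n+1}: a reduced word is a descending run of length σ 0 followed by the
shifted word of the tail. -/
theorem coxSym_succ (s : ℕ → R) (n : ℕ) :
    coxSym s (n + 1) =
      (∑ m ∈ Finset.range (n + 1), descProd s m) * coxSym (fun i => s (i + 1)) n := by
  rw [Finset.sum_range, coxSym, coxSym, Finset.sum_mul_sum, ← Fintype.sum_prod_type',
    ← (headTailEquiv n).sum_comp]
  refine Finset.sum_congr rfl fun σ _ => ?_
  simp [headTailEquiv, reducedWord, descProd, Function.comp_def]

theorem coxSym_zero (s : ℕ → R) : coxSym s 0 = 1 := by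
  simp [coxSym, reducedWord]

/-- The Coxeter relations of the symmetric group `S_n`. -/
structure CoxeterRel (s : ℕ → R) (n : ℕ) : Prop where
  sq : ∀ i, i + 1 < n → s i * s i = 1
  braid : ∀ i, i + 2 < n → s i * s (i + 1) * s i = s (i + 1) * s i * s (i + 1)
  comm : ∀ i j, i + 2 ≤ j → j + 1 < n → s i * s j = s j * s i

namespace CoxeterRel

variable {s : ℕ → R} {n : ℕ}

theorem shift (h : CoxeterRel s (n + 1)) : CoxeterRel (fun i => s (i + 1)) n where
  sq i hi := h.sq (i + 1) (by omega)
  braid i hi := h.braid (i + 1) (by omega)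
  comm i j hi hj := h.comm (i + 1) (j + 1) (by omega) (by omega)

theorem descProd_comm (h : CoxeterRel s n) (m j : ℕ) (hm : m + 1 ≤ j) (hj : j + 1 < n) :
    descProd s m * s j = s j * descProd s m := by
  induction m with
  | zero => simp
  | succ m ih =>
    rw [descProd_succ, mul_assoc, ih (by omega), ← mul_assoc, h.comm m j (by omega) hj, mul_assoc]

/-- The letter `s m` commutes with the run down to `s (m+1) * s m`, where the braid relation turns
it into `s (m+1)`, which commutes with the rest. -/
theorem mul_descProd (h : CoxeterRel s n) (m j : ℕ) (hm : m < j) (hj : j + 1 < n) :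
    s m * descProd s (j + 1) = descProd s (j + 1) * s (m + 1) := by
  induction j, hm using Nat.le_induction with
  | base =>
    rw [descProd_succ, descProd_succ]
    have := h.braid m (by omega)
    calc _ = (s m * s (m + 1) * s m) * descProd s m := by noncomm_ring
      _ = s (m + 1) * s m * (s (m + 1) * descProd s m) := by rw [this]; noncomm_ring
      _ = _ := by rw [← h.descProd_comm m (m + 1) (by omega) (by omega)]; noncomm_ring
  | succ j hmj ih =>
    rw [descProd_succ, ← mul_assoc, h.comm m (j + 1) (by omega) (by omega), mul_assoc,
      ih (by omega), mul_assoc]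

theorem descProd_mul_descProd (h : CoxeterRel s n) (m j : ℕ) (hm : m ≤ j) (hj : j + 1 < n) :
    descProd s m * descProd s (j + 1) =
      descProd s (j + 1) * descProd (fun i => s (i + 1)) m := by
  induction m with
  | zero => simp
  | succ m ih =>
    rw [descProd_succ, mul_assoc, ih (by omega), ← mul_assoc, h.mul_descProd m j (by omega) hj,
      descProd_succ (fun i => s (i + 1)) m, mul_assoc]

/-- Write D_m for `descProd s m` and D'_j for its shift. Since D'_j s_0 = D_{j+1}, the summand D_m
D'_j becomes D_m D_{j+1}. For m ≤ j this is D_{j+1} D'_m. For m > j the same identity read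
backwards, with s_0² = 1, gives D_j D'_{m-1}. So right multiplication by `s 0` permutes the summands
by an involution of the index pairs. -/
theorem sum_descProd_mul (h : CoxeterRel s (n + 2)) :
    (∑ m ∈ Finset.range (n + 2), descProd s m) *
      (∑ j ∈ Finset.range (n + 1), descProd (fun i => s (i + 1)) j) * s 0 =
    (∑ m ∈ Finset.range (n + 2), descProd s m) *
      ∑ j ∈ Finset.range (n + 1), descProd (fun i => s (i + 1)) j := by
  rw [mul_assoc, Finset.sum_mul (Finset.range (n + 1)), Finset.sum_mul_sum, Finset.sum_mul_sum, ← Finset.sum_product',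
    ← Finset.sum_product']
  have hi : ∀ x ∈ Finset.range (n + 2) ×ˢ Finset.range (n + 1),
      (if x.1 ≤ x.2 then (x.2 + 1, x.1) else (x.2, x.1 - 1)) ∈
        Finset.range (n + 2) ×ˢ Finset.range (n + 1) := by
    rintro ⟨m, j⟩ hx
    simp only [Finset.mem_product, Finset.mem_range] at hx ⊢
    split_ifs <;> constructor <;> dsimp only at * <;> omega
  have hinv : ∀ x ∈ Finset.range (n + 2) ×ˢ Finset.range (n + 1),
      (fun y : ℕ × ℕ => if y.1 ≤ y.2 then (y.2 + 1, y.1) else (y.2, y.1 - 1))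
        ((fun y : ℕ × ℕ => if y.1 ≤ y.2 then (y.2 + 1, y.1) else (y.2, y.1 - 1)) x) = x := by
    rintro ⟨m, j⟩ hx
    by_cases hmj : m ≤ j
    · simp [hmj]
    · have h1 : j ≤ m - 1 := by omega
      have h2 : m - 1 + 1 = m := by omega
      simp [hmj, h1, h2]
  refine Finset.sum_bij' (fun x _ => if x.1 ≤ x.2 then (x.2 + 1, x.1) else (x.2, x.1 - 1))
    (fun x _ => if x.1 ≤ x.2 then (x.2 + 1, x.1) else (x.2, x.1 - 1)) hi hi hinv hinv ?_
  rintro ⟨m, j⟩ hx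
  simp only [Finset.mem_product, Finset.mem_range] at hx ⊢
  rw [descProd_shift]
  split_ifs with hmj
  · exact h.descProd_mul_descProd m j hmj (by omega)
  · obtain ⟨l, rfl⟩ : ∃ l, m = l + 1 := ⟨m - 1, by omega⟩
    rw [Nat.add_sub_cancel, ← descProd_shift s j, ← mul_assoc,
      ← h.descProd_mul_descProd j l (by omega) (by omega), ← descProd_shift s l, mul_assoc,
      mul_assoc, h.sq 0 (by omega), mul_one]

end CoxeterRel

theorem coxSym_commute (s : ℕ → R) (n : ℕ) (x : R) (h : ∀ i, i + 1 < n → Commute (s i) x) :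
    Commute (coxSym s n) x := by
  induction n generalizing s with
  | zero => rw [coxSym_zero]; exact Commute.one_left x
  | succ n ih =>
    rw [coxSym_succ]
    refine Commute.mul_left (Commute.sum_left _ _ _ fun m hm => ?_)
      (ih _ fun i hi => h (i + 1) (by omega))
    have hm := Finset.mem_range.1 hm
    clear ih
    induction m with
    | zero => rw [descProd_zero]; exact Commute.one_left x
    | succ m ihm =>
      rw [descProd_succ]
      exact (h m (by omega)).mul_left (ihm (by simp; omega) (by omega))

/-- The symmetrizer absorbs the generators of the symmetric group. -/
theorem CoxeterRel.coxSym_mul {s : ℕ → R} {n : ℕ} (h : CoxeterRel s n) (i : ℕ) (hi : i + 1 < n) :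
    coxSym s n * s i = coxSym s n := by
  induction n generalizing s i with
  | zero => omega
  | succ n ih =>
    cases i with
    | succ i => rw [coxSym_succ, mul_assoc, ih h.shift i (by omega)]
    | zero =>
      obtain ⟨k, rfl⟩ : ∃ k, n = k + 1 := ⟨n - 1, by omega⟩
      -- After two coset decompositions the innermost symmetrizer involves only s_2, s_3, …, which
      -- commute with `s 0`; the two outer sums absorb `s 0`.
      have hc : Commute (coxSym (fun i => s (i + 1 + 1)) k) (s 0) :=
        coxSym_commute _ _ _ fun i hi => (h.comm 0 (i + 2) (by omega) (by omega)).symm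
      rw [coxSym_succ, coxSym_succ, mul_assoc, mul_assoc, hc.eq, ← mul_assoc, ← mul_assoc,
        h.sum_descProd_mul, mul_assoc]

end CoxeterSymmetrizer

/-! ### Braid operators on the tensor algebra -/

section BraidOperators

variable {K : Type*} [Field K] {X : Type*}

open FreeAlgebra (ι)

theorem basisFreeMonoid_apply (w : FreeMonoid X) :
    FreeAlgebra.basisFreeMonoid K X w = wordMonomial K w.toList := by
  simp [FreeAlgebra.basisFreeMonoid, wordMonomial, FreeAlgebra.equivMonoidAlgebraFreeMonoid,
    FreeMonoid.lift_apply]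

@[simp] theorem wordMonomial_nil : wordMonomial K ([] : List X) = 1 := rfl

@[simp] theorem wordMonomial_cons (x : X) (w : List X) :
    wordMonomial K (x :: w) = ι K x * wordMonomial K w := by
  simp [wordMonomial]

theorem wordMonomial_append (v w : List X) :
    wordMonomial K (v ++ w) = wordMonomial K v * wordMonomial K w := by
  simp [wordMonomial]

theorem span_wordMonomial :
    Submodule.span K (Set.range (wordMonomial K : List X → FreeAlgebra K X)) = ⊤ := by
  rw [← (FreeAlgebra.basisFreeMonoid K X).span_eq]
  congr 1
  ext u
  constructor
  · rintro ⟨w, rfl⟩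
    exact ⟨FreeMonoid.ofList w, by rw [basisFreeMonoid_apply]; rfl⟩
  · rintro ⟨w, rfl⟩
    exact ⟨w.toList, (basisFreeMonoid_apply w).symm⟩

theorem linearMap_ext_word {M : Type*} [AddCommGroup M] [Module K M]
    {f g : FreeAlgebra K X →ₗ[K] M} (h : ∀ w, f (wordMonomial K w) = g (wordMonomial K w)) :
    f = g :=
  (FreeAlgebra.basisFreeMonoid K X).ext fun w => by rw [basisFreeMonoid_apply]; exact h _

theorem wordMonomial_mem (w : List X) : wordMonomial K w ∈ tensorDegree K X w.length :=
  Submodule.subset_span ⟨w, rfl, rfl⟩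

theorem ι_mul_mem (x : X) {n : ℕ} {u : FreeAlgebra K X} (hu : u ∈ tensorDegree K X n) :
    ι K x * u ∈ tensorDegree K X (n + 1) := by
  induction hu using Submodule.span_induction with
  | mem u hu =>
    obtain ⟨w, rfl, rfl⟩ := hu
    exact Submodule.subset_span ⟨x :: w, rfl, by simp⟩
  | zero => simp
  | add u v _ _ hu hv => rw [mul_add]; exact add_mem hu hv
  | smul c u _ hu => rw [mul_smul_comm]; exact Submodule.smul_mem _ _ hu

theorem mul_mem_tensorDegree {m n : ℕ} {u v : FreeAlgebra K X} (hu : u ∈ tensorDegree K X m)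
    (hv : v ∈ tensorDegree K X n) : u * v ∈ tensorDegree K X (m + n) := by
  induction hu using Submodule.span_induction with
  | mem u hu =>
    obtain ⟨w, rfl, rfl⟩ := hu
    induction hv using Submodule.span_induction with
    | mem v hv =>
      obtain ⟨w', rfl, rfl⟩ := hv
      rw [← wordMonomial_append, ← List.length_append]
      exact wordMonomial_mem _
    | zero => simp
    | add u v _ _ hu hv => rw [mul_add]; exact add_mem hu hv
    | smul c u _ hu => rw [mul_smul_comm]; exact Submodule.smul_mem _ _ hu
  | zero => simp
  | add u v _ _ hu hv => rw [add_mul]; exact add_mem hu hv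
  | smul c u _ hu => rw [smul_mul_assoc]; exact Submodule.smul_mem _ _ hu

/-- Linear maps that agree on all `x_i u` agree on the next degree. -/
theorem eq_of_mem_tensorDegree_succ {M : Type*} [AddCommGroup M] [Module K M]
    {f g : FreeAlgebra K X →ₗ[K] M} {n : ℕ}
    (h : ∀ x, ∀ u ∈ tensorDegree K X n, f (ι K x * u) = g (ι K x * u))
    {v : FreeAlgebra K X} (hv : v ∈ tensorDegree K X (n + 1)) : f v = g v := by
  refine LinearMap.eqOn_span ?_ hv
  rintro _ ⟨w, hw, rfl⟩
  match w, hw with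
  | x :: w, hw =>
    rw [wordMonomial_cons]
    refine h x _ ?_
    rw [← Nat.succ_injective hw]
    exact wordMonomial_mem w

theorem eq_of_mem_tensorDegree_add_two {M : Type*} [AddCommGroup M] [Module K M]
    {f g : FreeAlgebra K X →ₗ[K] M} {n : ℕ}
    (h : ∀ x y, ∀ u ∈ tensorDegree K X n, f (ι K x * (ι K y * u)) = g (ι K x * (ι K y * u)))
    {v : FreeAlgebra K X} (hv : v ∈ tensorDegree K X (n + 2)) : f v = g v := by
  refine eq_of_mem_tensorDegree_succ (fun x u hu => ?_) hv
  have := eq_of_mem_tensorDegree_succ (f := f ∘ₗ LinearMap.mulLeft K (ι K x))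
    (g := g ∘ₗ LinearMap.mulLeft K (ι K x)) (fun y u hu => by simpa using h x y u hu) hu
  simpa using this

theorem eq_of_mem_tensorDegree_add_three {M : Type*} [AddCommGroup M] [Module K M]
    {f g : FreeAlgebra K X →ₗ[K] M} {n : ℕ}
    (h : ∀ x y z, ∀ u ∈ tensorDegree K X n,
      f (ι K x * (ι K y * (ι K z * u))) = g (ι K x * (ι K y * (ι K z * u))))
    {v : FreeAlgebra K X} (hv : v ∈ tensorDegree K X (n + 3)) : f v = g v := by
  refine eq_of_mem_tensorDegree_succ (fun x u hu => ?_) hv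
  have := eq_of_mem_tensorDegree_add_two (f := f ∘ₗ LinearMap.mulLeft K (ι K x))
    (g := g ∘ₗ LinearMap.mulLeft K (ι K x)) (fun y z u hu => by simpa using h x y z u hu) hu
  simpa using this

variable [Fintype X] (r : X → X → X → X → K)

theorem braidOp_wordMonomial (i : ℕ) (w : List X) :
    braidOp r i (wordMonomial K w) = braidWord r i w := by
  have := (FreeAlgebra.basisFreeMonoid K X).constr_basis K
    (fun w => braidWord r i w.toList) (FreeMonoid.ofList w)
  rwa [basisFreeMonoid_apply] at this

theorem braidOp_succ_mul (i : ℕ) (x : X) (u : FreeAlgebra K X) :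
    braidOp r (i + 1) (ι K x * u) = ι K x * braidOp r i u := by
  have : braidOp r (i + 1) ∘ₗ LinearMap.mulLeft K (ι K x) =
      LinearMap.mulLeft K (ι K x) ∘ₗ braidOp r i := by
    refine linearMap_ext_word fun w => ?_
    simp only [LinearMap.comp_apply, LinearMap.mulLeft_apply]
    rw [← wordMonomial_cons, braidOp_wordMonomial, braidOp_wordMonomial, braidWord]
  exact LinearMap.congr_fun this u

theorem braidOp_zero_mul (x y : X) (u : FreeAlgebra K X) :
    braidOp r 0 (ι K x * (ι K y * u)) =
      ∑ k, ∑ l, r x y k l • (ι K k * (ι K l * u)) := by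
  have : braidOp r 0 ∘ₗ LinearMap.mulLeft K (ι K x) ∘ₗ LinearMap.mulLeft K (ι K y) =
      ∑ k, ∑ l, r x y k l • (LinearMap.mulLeft K (ι K k) ∘ₗ LinearMap.mulLeft K (ι K l)) := by
    refine linearMap_ext_word fun w => ?_
    simp only [LinearMap.comp_apply, LinearMap.mulLeft_apply, LinearMap.sum_apply,
      LinearMap.smul_apply]
    rw [← wordMonomial_cons, ← wordMonomial_cons, braidOp_wordMonomial, braidWord]
    simp only [mul_assoc]
  simpa using LinearMap.congr_fun this u

theorem braidOp_mem {i n : ℕ} {u : FreeAlgebra K X} (hu : u ∈ tensorDegree K X n) :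
    braidOp r i u ∈ tensorDegree K X n := by
  induction hu using Submodule.span_induction with
  | zero => simp
  | add u v _ _ hu hv => rw [map_add]; exact add_mem hu hv
  | smul c u _ hu => rw [map_smul]; exact Submodule.smul_mem _ _ hu
  | mem u hu =>
    obtain ⟨w, rfl, rfl⟩ := hu
    induction i generalizing w with
    | zero =>
      match w with
      | [] => rw [braidOp_wordMonomial]; exact wordMonomial_mem _
      | [x] => rw [braidOp_wordMonomial]; exact wordMonomial_mem _
      | x :: y :: w =>
        rw [wordMonomial_cons, wordMonomial_cons, braidOp_zero_mul]
        exact sum_mem fun k _ => sum_mem fun l _ => Submodule.smul_mem _ _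
          (ι_mul_mem _ (ι_mul_mem _ (wordMonomial_mem w)))
    | succ i ih =>
      match w with
      | [] => rw [braidOp_wordMonomial]; exact wordMonomial_mem _
      | x :: w =>
        rw [wordMonomial_cons, braidOp_succ_mul]
        exact ι_mul_mem _ (ih w)

/-- The action of the `i`-th braid generator on `T^n(V)`. -/
def braidEnd (n i : ℕ) : End K (tensorDegree K X n) :=
  (braidOp r i).restrict fun _ => braidOp_mem r

theorem coe_braidEnd (n i : ℕ) (v : tensorDegree K X n) :
    (braidEnd r n i v : FreeAlgebra K X) = braidOp r i v := rfl

theorem coe_prod_braidEnd (n : ℕ) (l : List ℕ) (v : tensorDegree K X n) :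
    (((l.map (braidEnd r n)).prod v : tensorDegree K X n) : FreeAlgebra K X) =
      (l.map (braidOp r)).prod v := by
  induction l with
  | nil => simp
  | cons i l ih => simp [coe_braidEnd, ih]

theorem coe_coxSym_braidEnd (n : ℕ) (v : tensorDegree K X n) :
    (coxSym (braidEnd r n) n v : FreeAlgebra K X) = quantumSymmetrizer r n v := by
  simp [coxSym, quantumSymmetrizer, LinearMap.sum_apply, coe_prod_braidEnd]

/-- `r` are the structure constants of an involutive solution of the braid equation. -/
structure IsSymmetry : Prop where
  sq : ∀ x y u, braidOp r 0 (braidOp r 0 (ι K x * (ι K y * u))) = ι K x * (ι K y * u)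
  braid : ∀ x y z u,
    braidOp r 0 (braidOp r 1 (braidOp r 0 (ι K x * (ι K y * (ι K z * u))))) =
      braidOp r 1 (braidOp r 0 (braidOp r 1 (ι K x * (ι K y * (ι K z * u)))))

variable {r}

theorem IsSymmetry.braidOp_sq (h : IsSymmetry r) {i n : ℕ} (hi : i + 1 < n)
    {v : FreeAlgebra K X} (hv : v ∈ tensorDegree K X n) : braidOp r i (braidOp r i v) = v := by
  suffices H : (braidOp r i ∘ₗ braidOp r i) v = (LinearMap.id : _ →ₗ[K] _) v from H
  induction i generalizing n v with
  | zero =>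
    obtain ⟨m, rfl⟩ : ∃ m, n = m + 2 := ⟨n - 2, by omega⟩
    exact eq_of_mem_tensorDegree_add_two (fun x y u _ => h.sq x y u) hv
  | succ i ih =>
    obtain ⟨m, rfl⟩ : ∃ m, n = m + 1 := ⟨n - 1, by omega⟩
    refine eq_of_mem_tensorDegree_succ (fun x u hu => ?_) hv
    have := ih (by omega) hu
    simp only [LinearMap.comp_apply, LinearMap.id_apply] at this ⊢
    rw [braidOp_succ_mul, braidOp_succ_mul, this]

theorem IsSymmetry.braidOp_braid (h : IsSymmetry r) {i n : ℕ} (hi : i + 2 < n)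
    {v : FreeAlgebra K X} (hv : v ∈ tensorDegree K X n) :
    braidOp r i (braidOp r (i + 1) (braidOp r i v)) =
      braidOp r (i + 1) (braidOp r i (braidOp r (i + 1) v)) := by
  suffices H : (braidOp r i ∘ₗ braidOp r (i + 1) ∘ₗ braidOp r i) v =
      (braidOp r (i + 1) ∘ₗ braidOp r i ∘ₗ braidOp r (i + 1)) v from H
  induction i generalizing n v with
  | zero =>
    obtain ⟨m, rfl⟩ : ∃ m, n = m + 3 := ⟨n - 3, by omega⟩
    exact eq_of_mem_tensorDegree_add_three (fun x y z u _ => h.braid x y z u) hv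
  | succ i ih =>
    obtain ⟨m, rfl⟩ : ∃ m, n = m + 1 := ⟨n - 1, by omega⟩
    refine eq_of_mem_tensorDegree_succ (fun x u hu => ?_) hv
    have := ih (by omega) hu
    simp only [LinearMap.comp_apply] at this ⊢
    simp only [braidOp_succ_mul, this]

variable (r) in
theorem braidOp_comm {i j n : ℕ} (hij : i + 2 ≤ j) (hj : j + 1 < n)
    {v : FreeAlgebra K X} (hv : v ∈ tensorDegree K X n) :
    braidOp r i (braidOp r j v) = braidOp r j (braidOp r i v) := by
  suffices H : (braidOp r i ∘ₗ braidOp r j) v = (braidOp r j ∘ₗ braidOp r i) v from H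
  induction i generalizing j n v with
  | zero =>
    obtain ⟨m, rfl⟩ : ∃ m, n = m + 2 := ⟨n - 2, by omega⟩
    obtain ⟨j, rfl⟩ : ∃ l, j = l + 2 := ⟨j - 2, by omega⟩
    refine eq_of_mem_tensorDegree_add_two (fun x y u hu => ?_) hv
    simp only [LinearMap.comp_apply, braidOp_succ_mul, braidOp_zero_mul, map_sum, map_smul]
  | succ i ih =>
    obtain ⟨m, rfl⟩ : ∃ m, n = m + 1 := ⟨n - 1, by omega⟩
    obtain ⟨j, rfl⟩ : ∃ l, j = l + 1 := ⟨j - 1, by omega⟩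
    refine eq_of_mem_tensorDegree_succ (fun x u hu => ?_) hv
    have := ih (j := j) (by omega) (by omega) hu
    simp only [LinearMap.comp_apply] at this ⊢
    simp only [braidOp_succ_mul, this]

/-- The restriction to degree n matters: on words of length i + 2 the operator c_{i+1} is the
identity, so the braid relation would read c_i² = c_i there. -/
theorem IsSymmetry.coxeterRel (h : IsSymmetry r) (n : ℕ) : CoxeterRel (braidEnd r n) n where
  sq i hi := by
    ext v
    exact h.braidOp_sq hi v.2
  braid i hi := by
    ext v
    exact h.braidOp_braid hi v.2
  comm i j hij hj := by
    ext v
    exact braidOp_comm r hij hj v.2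

theorem IsSymmetry.quantumSymmetrizer_braidOp (h : IsSymmetry r) {i n : ℕ} (hi : i + 1 < n)
    {v : FreeAlgebra K X} (hv : v ∈ tensorDegree K X n) :
    quantumSymmetrizer r n (braidOp r i v) = quantumSymmetrizer r n v := by
  have := LinearMap.congr_fun ((h.coxeterRel n).coxSym_mul i hi) ⟨v, hv⟩
  rw [Module.End.mul_apply] at this
  have := congrArg Subtype.val this
  rwa [coe_coxSym_braidEnd, coe_coxSym_braidEnd] at this

end BraidOperators

/-! ### Nichols algebras of involutive braidings are quadratic -/

section Quadratic

variable {K : Type*} [Field K] {X : Type*} [Fintype X] {r : X → X → X → X → K}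

open FreeAlgebra (ι)

theorem smul_mem_twoSidedIdeal {A : Type*} [Ring A] [Algebra K A] (I : TwoSidedIdeal A) (c : K)
    {x : A} (hx : x ∈ I) : c • x ∈ I := by
  rw [Algebra.smul_def]
  exact I.mul_mem_left _ _ hx

/-- A two-sided ideal of an algebra, as a subspace. -/
def idealSubmodule (K : Type*) [Field K] {A : Type*} [Ring A] [Algebra K A]
    (I : TwoSidedIdeal A) : Submodule K A where
  carrier := I
  add_mem' := I.add_mem
  zero_mem' := I.zero_mem
  smul_mem' c _ hx := smul_mem_twoSidedIdeal I c hx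

theorem mem_idealSubmodule {A : Type*} [Ring A] [Algebra K A] {I : TwoSidedIdeal A} {x : A} :
    x ∈ idealSubmodule K I ↔ x ∈ I := Iff.rfl

/-- In other words, every c_i acts trivially on T(V)/I. Words too short for c_i are fixed by it, so
no degree condition is needed. -/
theorem sub_braidOp_mem {I : TwoSidedIdeal (FreeAlgebra K X)}
    (hI : ∀ x y, ι K x * ι K y - ∑ k, ∑ l, r x y k l • (ι K k * ι K l) ∈ I)
    (i : ℕ) (u : FreeAlgebra K X) : u - braidOp r i u ∈ I := by
  have key : ∀ w : List X, wordMonomial K w - braidOp r i (wordMonomial K w) ∈ I := by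
    intro w
    induction i generalizing w with
    | zero =>
      match w with
      | [] => rw [braidOp_wordMonomial]; simp [braidWord]
      | [x] => rw [braidOp_wordMonomial]; simp [braidWord]
      | x :: y :: w =>
        have := I.mul_mem_right _ (wordMonomial K w) (hI x y)
        rw [wordMonomial_cons, wordMonomial_cons, braidOp_zero_mul]
        simpa [sub_mul, Finset.sum_mul, mul_assoc] using this
    | succ i ih =>
      match w with
      | [] => rw [braidOp_wordMonomial]; simp [braidWord]
      | x :: w =>
        rw [wordMonomial_cons, braidOp_succ_mul, ← mul_sub]
        exact I.mul_mem_left _ _ (ih w)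
  have : u ∈ Submodule.span K (Set.range (wordMonomial K : List X → FreeAlgebra K X)) := by
    rw [span_wordMonomial]; trivial
  rw [← mem_idealSubmodule (K := K)]
  induction this using Submodule.span_induction with
  | mem u hu => obtain ⟨w, rfl⟩ := hu; exact key w
  | zero => simp
  | add u v _ _ hu hv =>
    rw [map_add, add_sub_add_comm]; exact add_mem hu hv
  | smul c u _ hu => rw [map_smul, ← smul_sub]; exact Submodule.smul_mem _ _ hu

/-- Modulo the relations `v = c v`, the quantum symmetrizer is multiplication by `n!`. -/
theorem factorial_smul_sub_quantumSymmetrizer_mem {I : TwoSidedIdeal (FreeAlgebra K X)}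
    (hI : ∀ x y, ι K x * ι K y - ∑ k, ∑ l, r x y k l • (ι K k * ι K l) ∈ I)
    (n : ℕ) (u : FreeAlgebra K X) :
    (n.factorial : K) • u - quantumSymmetrizer r n u ∈ I := by
  have key : ∀ l : List ℕ, u - (l.map (braidOp r)).prod u ∈ I := by
    intro l
    induction l with
    | nil => simp
    | cons i l ih =>
      -- Telescoping: u - c_i g u = (u - g u) + (g u - c_i g u).
      have := I.add_mem ih (sub_braidOp_mem hI i ((l.map (braidOp r)).prod u))
      simpa using this
  have : (n.factorial : K) • u - quantumSymmetrizer r n u =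
      ∑ σ : Equiv.Perm (Fin n), (u - ((reducedWord n σ).map (braidOp r)).prod u) := by
    simp [quantumSymmetrizer, LinearMap.sum_apply, Fintype.card_perm, Nat.cast_smul_eq_nsmul]
  rw [this]
  exact sum_mem fun σ _ => key _

theorem braidOp_zero_mul_right {s : FreeAlgebra K X} (hs : s ∈ tensorDegree K X 2)
    (u : FreeAlgebra K X) : braidOp r 0 (s * u) = braidOp r 0 s * u := by
  induction hs using Submodule.span_induction with
  | mem s hs =>
    obtain ⟨w, hw, rfl⟩ := hs
    match w, hw with
    | [x, y], _ =>
      simp only [wordMonomial_cons, mul_assoc, braidOp_zero_mul, wordMonomial_nil, one_mul,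
        Finset.sum_mul, smul_mul_assoc]
  | zero => simp
  | add u v _ _ hu hv => simp only [add_mul, map_add, hu, hv]
  | smul c u _ hu => simp only [smul_mul_assoc, map_smul, hu]

theorem braidOp_word_mul (v : List X) (u : FreeAlgebra K X) :
    braidOp r v.length (wordMonomial K v * u) = wordMonomial K v * braidOp r 0 u := by
  induction v with
  | nil => simp
  | cons x v ih => simp only [List.length_cons, wordMonomial_cons, mul_assoc, braidOp_succ_mul, ih]

/-- The Nichols algebra of an involutive braiding is quadratic: its ideal of relations is generated
by any set of eigenvectors of `c` for the eigenvalue `-1` that spans the relations `v = c v`. -/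
theorem nicholsSubspace_eq_span [CharZero K] (h : IsSymmetry r) {S : Set (FreeAlgebra K X)}
    (hI : ∀ x y, ι K x * ι K y - ∑ k, ∑ l, r x y k l • (ι K k * ι K l) ∈ TwoSidedIdeal.span S)
    (hS : ∀ s ∈ S, s ∈ tensorDegree K X 2) (hc : ∀ s ∈ S, braidOp r 0 s = -s) :
    (nicholsSubspace r : Set (FreeAlgebra K X)) = TwoSidedIdeal.span S := by
  apply Set.Subset.antisymm
  · suffices nicholsSubspace r ≤ idealSubmodule K (TwoSidedIdeal.span S) from this
    refine iSup_le fun n => iSup_le fun _ => fun v hv => ?_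
    have := factorial_smul_sub_quantumSymmetrizer_mem hI n v
    -- Here Q_n v = 0, so n! v lies in the ideal, and n! is invertible in characteristic zero.
    rw [LinearMap.mem_ker.1 hv.2, sub_zero, ← mem_idealSubmodule (K := K)] at this
    exact (Submodule.smul_mem_iff _ (by exact_mod_cast n.factorial_ne_zero)).1 this
  · have hword : ∀ s ∈ S, ∀ v w : List X,
        wordMonomial K v * s * wordMonomial K w ∈ nicholsSubspace r := by
      intro s hs v w
      refine Submodule.mem_iSup_of_mem (v.length + 2 + w.length)
        (Submodule.mem_iSup_of_mem (by omega) ?_)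
      have hm : wordMonomial K v * s * wordMonomial K w ∈
          tensorDegree K X (v.length + 2 + w.length) :=
        mul_mem_tensorDegree (mul_mem_tensorDegree (wordMonomial_mem v) (hS s hs))
          (wordMonomial_mem w)
      refine ⟨hm, ?_⟩
      -- At position `v.length` the braiding acts on the factor s alone, by -1. So Q_n takes the
      -- same value on v s w and on its negative, and that value is 0.
      have h1 := h.quantumSymmetrizer_braidOp (i := v.length) (by omega) hm
      rw [mul_assoc, braidOp_word_mul, braidOp_zero_mul_right (hS s hs), hc s hs, neg_mul, mul_neg,
        map_neg, ← mul_assoc, neg_eq_self] at h1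
      exact h1
    have hall : ∀ s ∈ S, ∀ u w, u * s * w ∈ nicholsSubspace r := by
      intro s hs u w
      have hu : u ∈ Submodule.span K (Set.range (wordMonomial K : List X → FreeAlgebra K X)) := by
        rw [span_wordMonomial]; trivial
      have hw : w ∈ Submodule.span K (Set.range (wordMonomial K : List X → FreeAlgebra K X)) := by
        rw [span_wordMonomial]; trivial
      induction hu using Submodule.span_induction with
      | mem u hu =>
        obtain ⟨u, rfl⟩ := hu
        induction hw using Submodule.span_induction with
        | mem w hw => obtain ⟨w, rfl⟩ := hw; exact hword s hs u w
        | zero => simp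
        | add u v _ _ hu hv => rw [mul_add]; exact add_mem hu hv
        | smul c u _ hu => rw [mul_smul_comm]; exact Submodule.smul_mem _ _ hu
      | zero => simp
      | add u v _ _ hu hv => rw [add_mul, add_mul]; exact add_mem hu hv
      | smul c u _ hu =>
        rw [smul_mul_assoc, smul_mul_assoc]; exact Submodule.smul_mem _ _ hu
    intro x hx
    have hx := TwoSidedIdeal.mem_span_iff_mem_addSubgroup_closure.1 hx
    refine (AddSubgroup.closure_le (nicholsSubspace r).toAddSubgroup).2 ?_ hx
    rintro _ ⟨_, ⟨u, -, s, hs, rfl⟩, w, -, rfl⟩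
    exact hall s hs u w

end Quadratic

/-! ### The braiding of type R_{1,6} as a symmetry -/

section BraidingR16

variable {K : Type*} [Field K] (t a b k p q : K)

open FreeAlgebra (ι)

/-- The values of the braiding of type `R_{1,6}`, in terms of any bilinear expression `f i j` in
the basis vectors. -/
def braidValue {M : Type*} [AddCommGroup M] [Module K M] (f : Fin 3 → Fin 3 → M) :
    Fin 3 → Fin 3 → M :=
  ![![t • f 0 0, t • f 1 0 - (t * a) • f 0 0, t • f 2 0 - (t * p) • f 0 0],
    ![t • f 0 1 + (t * a) • f 0 0,
      t • f 1 1 + (t * b) • f 1 0 - (t * b) • f 0 1 - (t * a * b) • f 0 0,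
      t • f 2 1 + (t * a) • f 2 0 - (t * p) • f 0 1 + (t * k) • f 0 0],
    ![t • f 0 2 + (t * p) • f 0 0,
      t • f 1 2 + (t * p) • f 1 0 - (t * a) • f 0 2 - (t * (2 * p * a + k)) • f 0 0,
      t • f 2 2 + (t * q) • f 2 0 - (t * q) • f 0 2 - (t * p * q) • f 0 0]]

theorem sum_braidingR16_smul {M : Type*} [AddCommGroup M] [Module K M] (f : Fin 3 → Fin 3 → M)
    (i j : Fin 3) :
    ∑ m, ∑ l, braidingR16 t a b k p q i j m l • f m l = braidValue t a b k p q f i j := by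
  fin_cases i <;> fin_cases j <;>
    simp [Fin.sum_univ_three, braidingR16, matrixR16, finProdFinEquiv, braidValue] <;> module

theorem braidOp_R16 (i j : Fin 3) (u : FreeAlgebra K (Fin 3)) :
    braidOp (braidingR16 t a b k p q) 0 (ι K i * (ι K j * u)) =
      braidValue t a b k p q (fun m l => ι K m * (ι K l * u)) i j := by
  rw [braidOp_zero_mul, sum_braidingR16_smul]

/-- The scalar t² is what separates the cases of the theorem: it rules out the eigenvalue -1 when t²
≠ 1 and makes c an involution when t² = 1. -/
theorem braidOp_R16_sq (i j : Fin 3) (u : FreeAlgebra K (Fin 3)) :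
    braidOp (braidingR16 t a b k p q) 0
      (braidOp (braidingR16 t a b k p q) 0 (ι K i * (ι K j * u))) =
      t ^ 2 • (ι K i * (ι K j * u)) := by
  fin_cases i <;> fin_cases j <;>
    simp [braidOp_R16, braidValue] <;> module

-- The braid equation is checked on all 27 triples of basis vectors. It holds for every t; only
-- involutivity restricts t.
set_option maxHeartbeats 1000000 in
theorem braidOp_R16_braid (i j l : Fin 3) (u : FreeAlgebra K (Fin 3)) :
    braidOp (braidingR16 t a b k p q) 0 (braidOp (braidingR16 t a b k p q) 1
      (braidOp (braidingR16 t a b k p q) 0 (ι K i * (ι K j * (ι K l * u))))) =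
    braidOp (braidingR16 t a b k p q) 1 (braidOp (braidingR16 t a b k p q) 0
      (braidOp (braidingR16 t a b k p q) 1 (ι K i * (ι K j * (ι K l * u))))) := by
  have h1 : ∀ x (v : FreeAlgebra K (Fin 3)), braidOp (braidingR16 t a b k p q) 1 (ι K x * v) =
    ι K x * braidOp (braidingR16 t a b k p q) 0 v := braidOp_succ_mul _ 0
  fin_cases i <;> fin_cases j <;> fin_cases l <;>
    simp [braidOp_R16, braidValue, h1, mul_add, mul_sub] <;> module

theorem isSymmetry_R16 (ht : t ^ 2 = 1) : IsSymmetry (braidingR16 t a b k p q) where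
  sq i j u := by rw [braidOp_R16_sq, ht, one_smul]
  braid := braidOp_R16_braid t a b k p q

end BraidingR16

/-! ### Quadratic relations and the ideals J(V) -/

section QuadraticRelations

variable {K : Type*} [Field K] (t a b k p q : K)

open FreeAlgebra (ι)

theorem quantumSymmetrizer_two {X : Type*} [Fintype X] (r : X → X → X → X → K) :
    quantumSymmetrizer r 2 = 1 + braidOp r 0 := by
  change coxSym (braidOp r) 2 = _
  simp [coxSym_succ, coxSym_zero, Finset.sum_range_succ, descProd_succ]

theorem nicholsRelations_two_eq_bot (ht : t ^ 2 ≠ 1) :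
    nicholsRelations (braidingR16 t a b k p q) 2 = ⊥ := by
  rw [eq_bot_iff]
  rintro v ⟨hv, hQ⟩
  rw [SetLike.mem_coe, LinearMap.mem_ker, quantumSymmetrizer_two, LinearMap.add_apply,
    Module.End.one_apply] at hQ
  set c := braidOp (braidingR16 t a b k p q) 0
  have h1 : c v = -v := (neg_eq_of_add_eq_zero_right hQ).symm
  have h2 : (c ∘ₗ c) v = (t ^ 2 • (LinearMap.id : _ →ₗ[K] FreeAlgebra K (Fin 3))) v :=
    eq_of_mem_tensorDegree_add_two (n := 0)
      (fun i j u _ => by simpa using! braidOp_R16_sq t a b k p q i j u) hv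
  have h3 : (t ^ 2 - 1) • v = 0 := by
    simp [h1] at h2
    rw [sub_smul, one_smul, ← h2, sub_self]
  exact (smul_eq_zero.1 h3).resolve_left (sub_ne_zero.2 ht)

theorem braidOp_R16_pair (i j : Fin 3) :
    braidOp (braidingR16 t a b k p q) 0 (ι K i * ι K j) =
      braidValue t a b k p q (fun m l => ι K m * ι K l) i j := by
  simpa using braidOp_R16 t a b k p q i j 1

theorem ι_mul_ι_mem (i j : Fin 3) : ι K i * ι K j ∈ tensorDegree K (Fin 3) 2 :=
  Submodule.subset_span ⟨[i, j], rfl, by simp⟩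

theorem relationsNeg_degree :
    ∀ s ∈ relationsNeg a b p q, s ∈ tensorDegree K (Fin 3) 2 := by
  have h := ι_mul_ι_mem (K := K)
  simp only [relationsNeg, x₁, x₂, x₃, pow_two, Set.mem_insert_iff, Set.mem_singleton_iff]
  rintro s (rfl | rfl | rfl | rfl | rfl | rfl)
  · exact add_mem (h _ _) (h _ _)
  · exact add_mem (h _ _) (h _ _)
  · exact sub_mem (sub_mem (add_mem (h _ _) (h _ _)) (Submodule.smul_mem _ _ (h _ _)))
      (Submodule.smul_mem _ _ (h _ _))
  · exact h _ _
  · exact sub_mem (h _ _) (Submodule.smul_mem _ _ (h _ _))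
  · exact sub_mem (h _ _) (Submodule.smul_mem _ _ (h _ _))

theorem relationsPos_degree :
    ∀ s ∈ relationsPos a k p, s ∈ tensorDegree K (Fin 3) 2 := by
  have h := ι_mul_ι_mem (K := K)
  simp only [relationsPos, x₁, x₂, x₃, pow_two, Set.mem_insert_iff, Set.mem_singleton_iff]
  rintro s (rfl | rfl | rfl)
  · exact sub_mem (sub_mem (h _ _) (h _ _)) (Submodule.smul_mem _ _ (h _ _))
  · exact sub_mem (sub_mem (h _ _) (h _ _)) (Submodule.smul_mem _ _ (h _ _))
  · exact add_mem (sub_mem (add_mem (sub_mem (h _ _) (h _ _)) (Submodule.smul_mem _ _ (h _ _)))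
      (Submodule.smul_mem _ _ (h _ _))) (Submodule.smul_mem _ _ (h _ _))

/-- The eigenvalue -1 is what makes the quantum symmetrizers kill the relations and all their
multiples. -/
theorem braidOp_relationsNeg :
    ∀ s ∈ relationsNeg a b p q, braidOp (braidingR16 (-1) a b k p q) 0 s = -s := by
  simp only [relationsNeg, x₁, x₂, x₃, pow_two, Set.mem_insert_iff, Set.mem_singleton_iff]
  rintro s (rfl | rfl | rfl | rfl | rfl | rfl) <;>
    simp only [map_add, map_sub, map_smul, braidOp_R16_pair] <;> simp [braidValue] <;> module

theorem braidOp_relationsPos :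
    ∀ s ∈ relationsPos a k p, braidOp (braidingR16 1 a b k p q) 0 s = -s := by
  simp only [relationsPos, x₁, x₂, x₃, pow_two, Set.mem_insert_iff, Set.mem_singleton_iff]
  rintro s (rfl | rfl | rfl) <;>
    simp only [map_add, map_sub, map_smul, braidOp_R16_pair] <;> simp [braidValue] <;> module

/-- Each v - c v is already a linear combination of the degree 2 relations, with coefficients found
by matching the squares and the unordered monomials. -/
theorem sub_braidValue_mem_relationsNeg (i j : Fin 3) :
    ι K i * ι K j - ∑ m, ∑ l, braidingR16 (-1) a b k p q i j m l • (ι K m * ι K l) ∈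
      TwoSidedIdeal.span (relationsNeg a b p q) := by
  rw [sum_braidingR16_smul, ← mem_idealSubmodule (K := K)]
  set N := idealSubmodule K (TwoSidedIdeal.span (relationsNeg a b p q))
  have h : relationsNeg a b p q ⊆ N := TwoSidedIdeal.subset_span
  simp only [relationsNeg, x₁, x₂, x₃, pow_two, Set.insert_subset_iff,
    Set.singleton_subset_iff, SetLike.mem_coe] at h
  obtain ⟨h1, h2, h3, h4, h5, h6⟩ := h
  have e (c : K) {v} (hv : v ∈ N) : c • v ∈ N := N.smul_mem c hv
  fin_cases i <;> fin_cases j <;> simp [braidValue]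
  · convert e 2 h4 using 1; module
  · convert add_mem h1 (e (-a) h4) using 1; module
  · convert add_mem h2 (e (-p) h4) using 1; module
  · convert add_mem h1 (e a h4) using 1; module
  · convert add_mem (e 2 h5) (add_mem (e b h1) (e (-(a * b)) h4)) using 1; module
  · convert add_mem h3 (add_mem (e a h2) (e k h4)) using 1; module
  · convert add_mem h2 (e p h4) using 1; module
  · convert add_mem h3 (add_mem (e p h1) (e (-(2 * p * a + k)) h4)) using 1; module
  · convert add_mem (e 2 h6) (add_mem (e q h2) (e (-(p * q)) h4)) using 1; module

theorem sub_braidValue_mem_relationsPos (i j : Fin 3) :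
    ι K i * ι K j - ∑ m, ∑ l, braidingR16 1 a b k p q i j m l • (ι K m * ι K l) ∈
      TwoSidedIdeal.span (relationsPos a k p) := by
  rw [sum_braidingR16_smul, ← mem_idealSubmodule (K := K)]
  set N := idealSubmodule K (TwoSidedIdeal.span (relationsPos a k p))
  have h : relationsPos a k p ⊆ N := TwoSidedIdeal.subset_span
  simp only [relationsPos, x₁, x₂, x₃, pow_two, Set.insert_subset_iff,
    Set.singleton_subset_iff, SetLike.mem_coe] at h
  obtain ⟨h1, h2, h3⟩ := h
  have e (c : K) {v} (hv : v ∈ N) : c • v ∈ N := N.smul_mem c hv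
  fin_cases i <;> fin_cases j <;> simp [braidValue]
  -- For t = 1 the difference at x_1 x_1 vanishes, so eight of the nine pairs remain.
  · convert e (-1) h1 using 1; module
  · convert e (-1) h2 using 1; module
  · convert h1 using 1; module
  · convert e (-b) h1 using 1; module
  · convert add_mem (e (-1) h3) (e (-a) h2) using 1; module
  · convert h2 using 1; module
  · convert add_mem h3 (e (-p) h1) using 1; module
  · convert e (-q) h2 using 1; module

theorem nicholsSubspace_R16_neg [CharZero K] :
    (nicholsSubspace (braidingR16 (-1) a b k p q) : Set (FreeAlgebra K (Fin 3))) =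
      TwoSidedIdeal.span (relationsNeg a b p q) :=
  nicholsSubspace_eq_span (isSymmetry_R16 _ a b k p q (by norm_num))
    (sub_braidValue_mem_relationsNeg a b k p q) (relationsNeg_degree a b p q)
    (braidOp_relationsNeg a b k p q)

theorem nicholsSubspace_R16_pos [CharZero K] :
    (nicholsSubspace (braidingR16 1 a b k p q) : Set (FreeAlgebra K (Fin 3))) =
      TwoSidedIdeal.span (relationsPos a k p) :=
  nicholsSubspace_eq_span (isSymmetry_R16 _ a b k p q (by norm_num))
    (sub_braidValue_mem_relationsPos a b k p q) (relationsPos_degree a k p)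
    (braidOp_relationsPos a b k p q)

/-- If `J(V)` is a two-sided ideal, then it is the ideal by which `T(V)` is divided. -/
theorem nicholsIdeal_eq_of_coe_eq {X : Type*} [Fintype X] {r : X → X → X → X → K}
    {I : TwoSidedIdeal (FreeAlgebra K X)}
    (h : (nicholsSubspace r : Set (FreeAlgebra K X)) = I) : nicholsIdeal r = I := by
  rw [nicholsIdeal, h]
  exact le_antisymm (TwoSidedIdeal.span_le.2 subset_rfl) TwoSidedIdeal.subset_span

theorem nicholsIdeal_R16_neg [CharZero K] :
    nicholsIdeal (braidingR16 (-1) a b k p q) = TwoSidedIdeal.span (relationsNeg a b p q) :=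
  nicholsIdeal_eq_of_coe_eq (nicholsSubspace_R16_neg a b k p q)

theorem nicholsIdeal_R16_pos [CharZero K] :
    nicholsIdeal (braidingR16 1 a b k p q) = TwoSidedIdeal.span (relationsPos a k p) :=
  nicholsIdeal_eq_of_coe_eq (nicholsSubspace_R16_pos a b k p q)

end QuadraticRelations

/-! ### The Nichols algebra as an algebra with generators and relations -/

section Presentation

variable {K : Type*} [Field K] {X : Type*} [Fintype X] (r : X → X → X → X → K)

open FreeAlgebra (ι)

/-- The projection `T(V) → B(V)`. -/
def projection : FreeAlgebra K X →ₐ[K] NicholsAlgebra r :=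
  { (nicholsIdeal r).ringCon.mk' with commutes' := fun _ => rfl }

theorem projection_ι (i : X) : projection r (ι K i) = gen r i := rfl

theorem projection_surjective : Function.Surjective (projection r) :=
  (nicholsIdeal r).ringCon.mk'_surjective

variable {r}

theorem projection_eq_zero_iff {u : FreeAlgebra K X} :
    projection r u = 0 ↔ u ∈ nicholsIdeal r := by
  have h : u ∈ TwoSidedIdeal.ker (nicholsIdeal r).ringCon.mk' ↔ u ∈ nicholsIdeal r := by
    rw [TwoSidedIdeal.ker_ringCon_mk']
  rw [← h, TwoSidedIdeal.mem_ker]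
  rfl

/-- A subspace of `B(V)` that contains `1` and is stable under the left multiplication by the
generators is the whole algebra. -/
theorem submodule_eq_top_of_gen_mul_mem {N : Submodule K (NicholsAlgebra r)} (h1 : 1 ∈ N)
    (hN : ∀ i, ∀ v ∈ N, gen r i * v ∈ N) : N = ⊤ := by
  have hw : ∀ w : List X, projection r (wordMonomial K w) ∈ N := by
    intro w
    induction w with
    | nil => simpa using h1
    | cons x w ih => rw [wordMonomial_cons, map_mul, projection_ι]; exact hN _ _ ih
  have : N.comap (projection r).toLinearMap = ⊤ := by
    rw [eq_top_iff, ← span_wordMonomial, Submodule.span_le]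
    rintro _ ⟨w, rfl⟩
    exact hw w
  rw [eq_top_iff]
  intro v _
  obtain ⟨u, rfl⟩ := projection_surjective r v
  have hu : u ∈ N.comap (projection r).toLinearMap := by rw [this]; trivial
  exact hu

/-- The universal property of a Nichols algebra whose relations are known. -/
theorem exists_algHom_of_relations {S : Set (FreeAlgebra K X)}
    (hS : nicholsIdeal r = TwoSidedIdeal.span S) {B : Type*} [Ring B] [Algebra K B] (f : X → B)
    (hf : ∀ s ∈ S, FreeAlgebra.lift K f s = 0) :
    ∃ ψ : NicholsAlgebra r →ₐ[K] B, ∀ i, ψ (gen r i) = f i := by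
  have hker : ∀ u ∈ nicholsIdeal r, FreeAlgebra.lift K f u = 0 := by
    have : nicholsIdeal r ≤ TwoSidedIdeal.ker (FreeAlgebra.lift K f) := by
      rw [hS, TwoSidedIdeal.span_le]
      intro s hs
      exact (TwoSidedIdeal.mem_ker _).2 (hf s hs)
    exact fun u hu => (TwoSidedIdeal.mem_ker _).1 (this hu)
  refine ⟨{ RingCon.lift (nicholsIdeal r).ringCon (FreeAlgebra.lift K f : FreeAlgebra K X →+* B)
    ?_ with commutes' := fun c => ?_ }, fun i => ?_⟩
  · intro u v huv
    have := hker _ ((TwoSidedIdeal.rel_iff _ _ _).1 huv)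
    rw [map_sub, sub_eq_zero] at this
    exact this
  · exact (FreeAlgebra.lift K f).commutes c
  · exact FreeAlgebra.lift_ι_apply f i

end Presentation

/-! ### The eight-element basis for t = -1 -/

section NegativeCase

variable {K : Type*} [Field K]

/-- The relations for `t = -1` rewrite every product into a combination of the monomials
`x^i y^j z^k` with `i, j, k < 2`. -/
theorem mul_mem_span_of_relationsNeg {A : Type*} [Ring A] [Algebra K A] {a b p q : K} {x y z : A}
    (hyx : y * x = -(x * y)) (hzx : z * x = -(x * z))
    (hzy : z * y = -(y * z) + a • (x * z) + p • (x * y))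
    (hxx : x * x = 0) (hyy : y * y = b • (x * y)) (hzz : z * z = q • (x * z)) {v : A}
    (hv : v ∈ Submodule.span K (Set.range fun e : Fin 2 × Fin 2 × Fin 2 =>
      x ^ (e.1 : ℕ) * y ^ (e.2.1 : ℕ) * z ^ (e.2.2 : ℕ))) (g : A) (hg : g = x ∨ g = y ∨ g = z) :
    g * v ∈ Submodule.span K (Set.range fun e : Fin 2 × Fin 2 × Fin 2 =>
      x ^ (e.1 : ℕ) * y ^ (e.2.1 : ℕ) * z ^ (e.2.2 : ℕ)) := by
  set N := Submodule.span K (Set.range fun e : Fin 2 × Fin 2 × Fin 2 =>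
      x ^ (e.1 : ℕ) * y ^ (e.2.1 : ℕ) * z ^ (e.2.2 : ℕ)) with hN
  have hmem (e : Fin 2 × Fin 2 × Fin 2) :
      x ^ (e.1 : ℕ) * y ^ (e.2.1 : ℕ) * z ^ (e.2.2 : ℕ) ∈ N := Submodule.subset_span ⟨e, rfl⟩
  have n1 : x ∈ N := by simpa using hmem (1, 0, 0)
  have n2 : y ∈ N := by simpa using hmem (0, 1, 0)
  have n3 : z ∈ N := by simpa using hmem (0, 0, 1)
  have n4 : x * y ∈ N := by simpa using hmem (1, 1, 0)
  have n5 : x * z ∈ N := by simpa using hmem (1, 0, 1)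
  have n6 : y * z ∈ N := by simpa using hmem (0, 1, 1)
  have n7 : x * (y * z) ∈ N := by simpa [mul_assoc] using hmem (1, 1, 1)
  -- The primed rules apply the relations at the head of a right-nested product. None is needed for
  -- z z, because z is the last letter of an ordered monomial.
  have hyx' (w : A) : y * (x * w) = -(x * (y * w)) := by rw [← mul_assoc, hyx]; noncomm_ring
  have hzx' (w : A) : z * (x * w) = -(x * (z * w)) := by rw [← mul_assoc, hzx]; noncomm_ring
  have hxx' (w : A) : x * (x * w) = 0 := by rw [← mul_assoc, hxx, zero_mul]
  have hyy' (w : A) : y * (y * w) = b • (x * (y * w)) := by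
    rw [← mul_assoc, hyy, smul_mul_assoc, mul_assoc]
  have hzy' (w : A) : z * (y * w) = -(y * (z * w)) + a • (x * (z * w)) + p • (x * (y * w)) := by
    rw [← mul_assoc, hzy]; simp only [add_mul, neg_mul, smul_mul_assoc, mul_assoc]
  induction hv using Submodule.span_induction with
  | mem v hv =>
    obtain ⟨⟨i, j, k⟩, rfl⟩ := hv
    rcases hg with rfl | rfl | rfl <;> fin_cases i <;> fin_cases j <;> fin_cases k <;>
      simp [mul_assoc, mul_add, hyx, hyx', hzx, hzx', hzy, hzy', hxx, hxx', hyy, hyy', hzz] <;>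
      repeat first
        | assumption
        | apply add_mem
        | apply neg_mem
        | apply Submodule.smul_mem
  | zero => simp
  | add u v _ _ hu hv => rw [mul_add]; exact add_mem hu hv
  | smul c u _ hu => rw [mul_smul_comm]; exact Submodule.smul_mem _ _ hu

/-- The left multiplication by `x_1` in the basis `x_1^i x_2^j x_3^k`, numbered by
`4 i + 2 j + k`, for `t = -1`. -/
def negOp₁ (K : Type*) [Field K] : End K (Fin 8 → K) where
  toFun v := ![0, 0, 0, 0, v 0, v 1, v 2, v 3]
  map_add' u v := by ext i; fin_cases i <;> simp
  map_smul' c v := by ext i; fin_cases i <;> simp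

/-- The left multiplication by `x_2`. -/
def negOp₂ (b : K) : End K (Fin 8 → K) where
  toFun v := ![0, 0, v 0, v 1, 0, 0, b * v 2 - v 4, b * v 3 - v 5]
  map_add' u v := by ext i; fin_cases i <;> simp <;> ring
  map_smul' c v := by ext i; fin_cases i <;> simp <;> ring

/-- The left multiplication by `x_3`. -/
def negOp₃ (a p q : K) : End K (Fin 8 → K) where
  toFun v := ![0, v 0, 0, -v 2, 0, q * v 1 + a * v 2 - v 4, p * v 2, (q + p) * v 3 + v 6]
  map_add' u v := by ext i; fin_cases i <;> simp <;> ring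
  map_smul' c v := by ext i; fin_cases i <;> simp <;> ring

/-- The three operators are read off from the straightening rules. Checking the relations on them
makes K^8 a module over B(V) without presupposing its dimension. -/
theorem lift_negOp_relationsNeg (a b p q : K) :
    ∀ s ∈ relationsNeg a b p q,
      FreeAlgebra.lift K ![negOp₁ K, negOp₂ b, negOp₃ a p q] s = 0 := by
  simp only [relationsNeg, x₁, x₂, x₃, pow_two, Set.mem_insert_iff, Set.mem_singleton_iff]
  rintro s (rfl | rfl | rfl | rfl | rfl | rfl) <;>
    simp only [map_add, map_sub, map_smul, map_mul, FreeAlgebra.lift_ι_apply] <;>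
    refine LinearMap.ext fun v => funext fun i => ?_ <;>
    fin_cases i <;> simp [negOp₁, negOp₂, negOp₃] <;> ring

/-- The images of the monomials `x_1^i x_2^j x_3^k`, `i, j, k < 2`, in `B(V)`. -/
def monomialNeg (r : Fin 3 → Fin 3 → Fin 3 → Fin 3 → K) (e : Fin 2 × Fin 2 × Fin 2) :
    NicholsAlgebra r :=
  gen r 0 ^ (e.1 : ℕ) * gen r 1 ^ (e.2.1 : ℕ) * gen r 2 ^ (e.2.2 : ℕ)

variable (a b k p q : K)

theorem linearIndependent_monomialNeg [CharZero K] :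
    LinearIndependent K (monomialNeg (braidingR16 (-1) a b k p q)) := by
  obtain ⟨ψ, hψ⟩ := exists_algHom_of_relations (nicholsIdeal_R16_neg a b k p q) _
    (lift_negOp_relationsNeg a b p q)
  -- The vector e_0 plays the role of the monomial 1, so each ordered monomial sends it to the basis
  -- vector with its own number.
  let ev : NicholsAlgebra (braidingR16 (-1) a b k p q) →ₗ[K] Fin 8 → K :=
    LinearMap.applyₗ (Pi.single 0 1) ∘ₗ ψ.toLinearMap
  let idx : Fin 2 × Fin 2 × Fin 2 → Fin 8 := fun e =>
    ⟨4 * e.1 + 2 * e.2.1 + e.2.2, by omega⟩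
  refine LinearIndependent.of_comp ev ?_
  have : ev ∘ monomialNeg (braidingR16 (-1) a b k p q) = Pi.basisFun K (Fin 8) ∘ idx := by
    funext ⟨i, j, l⟩
    simp only [Function.comp_apply, ev, idx, monomialNeg, Pi.basisFun_apply]
    refine funext fun m => ?_
    fin_cases i <;> fin_cases j <;> fin_cases l <;> fin_cases m <;>
      simp [hψ, negOp₁, negOp₂, negOp₃]
  rw [this]
  refine (Pi.basisFun K (Fin 8)).linearIndependent.comp idx ?_
  decide

theorem projection_relation {r : Fin 3 → Fin 3 → Fin 3 → Fin 3 → K}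
    {S : Set (FreeAlgebra K (Fin 3))} (hS : nicholsIdeal r = TwoSidedIdeal.span S)
    {s : FreeAlgebra K (Fin 3)} (hs : s ∈ S) : projection r s = 0 := by
  rw [projection_eq_zero_iff, hS]
  exact TwoSidedIdeal.subset_span hs

theorem span_monomialNeg [CharZero K] :
    Submodule.span K (Set.range (monomialNeg (braidingR16 (-1) a b k p q))) = ⊤ := by
  have h : ∀ s ∈ relationsNeg a b p q, projection (braidingR16 (-1) a b k p q) s = 0 :=
    fun s hs => projection_relation (nicholsIdeal_R16_neg a b k p q) hs
  simp only [relationsNeg, Set.forall_mem_insert, Set.mem_singleton_iff, forall_eq, x₁, x₂, x₃,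
    map_add, map_sub, map_smul, map_mul, projection_ι, pow_two] at h
  obtain ⟨h1, h2, h3, h4, h5, h6⟩ := h
  refine submodule_eq_top_of_gen_mul_mem
    (Submodule.subset_span ⟨(0, 0, 0), by simp [monomialNeg]⟩) fun i v hv => ?_
  refine mul_mem_span_of_relationsNeg (eq_neg_of_add_eq_zero_left h1)
    (eq_neg_of_add_eq_zero_left h2) (a := a) (p := p) ?_ h4 (sub_eq_zero.1 h5)
    (sub_eq_zero.1 h6) hv _ ?_
  · rw [← sub_eq_zero, ← h3]; abel
  · fin_cases i <;> simp

/-- The basis of the Nichols algebra for `t = -1`. -/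
def basisNeg [CharZero K] :
    Basis (Fin 2 × Fin 2 × Fin 2) K (NicholsAlgebra (braidingR16 (-1) a b k p q)) :=
  Basis.mk (linearIndependent_monomialNeg a b k p q) (span_monomialNeg a b k p q).ge

end NegativeCase

/-! ### Gelfand–Kirillov dimension of a finite-dimensional algebra -/

section GKdim

variable {K A : Type*} [Field K] [Ring A] [Algebra K A]

/-- The numerators are bounded by log dim A while log n tends to infinity. -/
theorem GKdim_eq_zero_of_finite [Module.Finite K A] : GKdim K A = 0 := by
  have key : ∀ W : {W : Submodule K A // W.FG}, limsup (fun n : ℕ =>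
      ((Real.log (finrank K (⨆ i : Fin (n + 1), W.1 ^ (i : ℕ) : Submodule K A)) / Real.log n : ℝ)
        : EReal)) atTop = 0 := by
    intro W
    have ht : Tendsto (fun n : ℕ => Real.log (finrank K
        (⨆ i : Fin (n + 1), W.1 ^ (i : ℕ) : Submodule K A)) / Real.log n) atTop (nhds 0) := by
      refine squeeze_zero (g := fun n : ℕ => Real.log (finrank K A) / Real.log n) (fun n => ?_)
        (fun n => ?_)
        ((Real.tendsto_log_atTop.comp tendsto_natCast_atTop_atTop).const_div_atTop _)
      · exact div_nonneg (Real.log_natCast_nonneg _) (Real.log_natCast_nonneg _)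
      · refine div_le_div_of_nonneg_right ?_ (Real.log_natCast_nonneg _)
        rcases Nat.eq_zero_or_pos (finrank K
          (⨆ i : Fin (n + 1), W.1 ^ (i : ℕ) : Submodule K A)) with h | h
        · rw [h]; simpa using Real.log_natCast_nonneg _
        · exact Real.log_le_log (by exact_mod_cast h) (by exact_mod_cast Submodule.finrank_le _)
    exact ((continuous_coe_real_ereal.tendsto 0).comp ht).limsup_eq
  rw [GKdim, iSup_congr key]
  -- Nonemptiness matters: an empty supremum in `EReal` would be -∞.
  have : Nonempty {W : Submodule K A // W.FG} := ⟨⟨⊥, Submodule.fg_bot⟩⟩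
  exact ciSup_const

end GKdim

/-! ### Filtration by ordered monomials and cubic growth -/

section Filtration

variable {K A : Type*} [Field K] [Ring A] [Algebra K A]

/-- The monomial `x^i y^j z^k`. -/
def pbwMonomial (x y z : A) (e : ℕ × ℕ × ℕ) : A := x ^ e.1 * y ^ e.2.1 * z ^ e.2.2

/-- The span of the monomials `x^i y^j z^k` with `i + j + k ≤ m`. -/
def pbwFiltration (K : Type*) [Field K] {A : Type*} [Ring A] [Algebra K A] (x y z : A) (m : ℕ) :
    Submodule K A :=
  Submodule.span K (pbwMonomial x y z '' {e | e.1 + e.2.1 + e.2.2 ≤ m})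

variable {x y z : A}

theorem pbwMonomial_mem {m : ℕ} (i j k : ℕ) (h : i + j + k ≤ m) :
    x ^ i * y ^ j * z ^ k ∈ pbwFiltration K x y z m :=
  Submodule.subset_span ⟨(i, j, k), h, rfl⟩

theorem pbwFiltration_mono {m n : ℕ} (h : m ≤ n) :
    pbwFiltration K x y z m ≤ pbwFiltration K x y z n :=
  Submodule.span_mono (Set.image_mono fun _ (he : _ ≤ m) => le_trans he h)

/-- To check that a left multiplication raises the filtration, it suffices to treat monomials. -/
theorem mul_mem_pbwFiltration {g : A} {d m : ℕ}
    (h : ∀ i j k, i + j + k ≤ m → g * (x ^ i * y ^ j * z ^ k) ∈ pbwFiltration K x y z (m + d))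
    {v : A} (hv : v ∈ pbwFiltration K x y z m) : g * v ∈ pbwFiltration K x y z (m + d) := by
  induction hv using Submodule.span_induction with
  | mem v hv => obtain ⟨⟨i, j, k⟩, he, rfl⟩ := hv; exact h i j k he
  | zero => simp
  | add u v _ _ hu hv => rw [mul_add]; exact add_mem hu hv
  | smul c u _ hu => rw [mul_smul_comm]; exact Submodule.smul_mem _ _ hu

theorem left_mul_mem_pbwFiltration {m : ℕ} {v : A} (hv : v ∈ pbwFiltration K x y z m) :
    x * v ∈ pbwFiltration K x y z (m + 1) := by
  refine mul_mem_pbwFiltration (fun i j k h => ?_) hv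
  rw [← mul_assoc, ← mul_assoc, ← pow_succ']
  exact pbwMonomial_mem _ _ _ (by omega)

theorem left_pow_mul_mem_pbwFiltration {m : ℕ} {v : A} (hv : v ∈ pbwFiltration K x y z m) (i : ℕ) :
    x ^ i * v ∈ pbwFiltration K x y z (m + i) := by
  induction i with
  | zero => simpa using hv
  | succ i ih => rw [pow_succ', mul_assoc]; exact left_mul_mem_pbwFiltration ih

/-- The commutator with g is a derivation sending x to c x², so it acts on powers of x like c x²
d/dx. -/
theorem mul_pow_of_commutator {g : A} {c : K} (h : g * x = x * g + c • (x * x)) (i : ℕ) :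
    g * x ^ i = x ^ i * g + (c * i) • x ^ (i + 1) := by
  induction i with
  | zero => simp
  | succ i ih =>
    rw [pow_succ, ← mul_assoc, ih, add_mul, mul_assoc, h, mul_add, mul_smul_comm, smul_mul_assoc,
      ← pow_succ, ← mul_assoc, ← mul_assoc, ← pow_succ, ← pow_succ]
    push_cast
    module

theorem middle_mul_mem_pbwFiltration {a : K} (hyx : y * x = x * y + a • (x * x)) {m : ℕ} {v : A}
    (hv : v ∈ pbwFiltration K x y z m) : y * v ∈ pbwFiltration K x y z (m + 1) := by
  refine mul_mem_pbwFiltration (fun i j k h => ?_) hv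
  rw [← mul_assoc, ← mul_assoc, mul_pow_of_commutator hyx, add_mul, add_mul, mul_assoc (x ^ i),
    ← pow_succ', smul_mul_assoc, smul_mul_assoc]
  exact add_mem (pbwMonomial_mem _ _ _ (by omega))
    (Submodule.smul_mem _ _ (pbwMonomial_mem _ _ _ (by omega)))

/-- Moving z past x^i costs only the multiple of x^{i+1} from `mul_pow_of_commutator`; moving it
past y^j needs the induction in `key`. -/
theorem right_mul_mem_pbwFiltration {a p c : K} (hyx : y * x = x * y + a • (x * x))
    (hzx : z * x = x * z + p • (x * x))
    (hzy : z * y = y * z - a • (x * z) + p • (x * y) - c • (x * x)) {m : ℕ} {v : A}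
    (hv : v ∈ pbwFiltration K x y z m) : z * v ∈ pbwFiltration K x y z (m + 1) := by
  have key : ∀ j k, z * (y ^ j * z ^ k) ∈ pbwFiltration K x y z (j + k + 1) := by
    intro j k
    induction j with
    | zero =>
      have := pbwMonomial_mem (K := K) (x := x) (y := y) (z := z) 0 0 (k + 1) le_rfl
      simpa [pow_succ'] using this
    | succ j ih =>
      have hm : y ^ j * z ^ k ∈ pbwFiltration K x y z (j + k) := by
        have := pbwMonomial_mem (K := K) (x := x) (y := y) (z := z) 0 j k (m := j + k) (by omega)
        simpa using this
      -- In each term z meets only y^j or has disappeared, so the induction hypothesis and the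
      -- bounds for x and y suffice.
      have e : z * (y ^ (j + 1) * z ^ k) = y * (z * (y ^ j * z ^ k)) -
          a • (x * (z * (y ^ j * z ^ k))) + p • (x * (y * (y ^ j * z ^ k))) -
          c • (x * (x * (y ^ j * z ^ k))) := by
        rw [pow_succ', mul_assoc, ← mul_assoc z y, hzy]
        simp only [sub_mul, add_mul, smul_mul_assoc, mul_assoc]
      have hj : j + 1 + k + 1 = j + k + 1 + 1 := by omega
      rw [e, hj]
      exact sub_mem (add_mem (sub_mem (middle_mul_mem_pbwFiltration hyx ih)
        (Submodule.smul_mem _ _ (left_mul_mem_pbwFiltration ih)))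
        (Submodule.smul_mem _ _
          (left_mul_mem_pbwFiltration (middle_mul_mem_pbwFiltration hyx hm))))
        (Submodule.smul_mem _ _ (left_mul_mem_pbwFiltration (left_mul_mem_pbwFiltration hm)))
  refine mul_mem_pbwFiltration (fun i j k h => ?_) hv
  rw [mul_assoc, ← mul_assoc, mul_pow_of_commutator hzx, add_mul, mul_assoc, smul_mul_assoc,
    ← mul_assoc (x ^ (i + 1))]
  exact add_mem (pbwFiltration_mono (by omega) (left_pow_mul_mem_pbwFiltration (key j k) i))
    (Submodule.smul_mem _ _ (pbwMonomial_mem _ _ _ (by omega)))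

theorem iSup_pbwFiltration :
    ⨆ m, pbwFiltration K x y z m = Submodule.span K (Set.range (pbwMonomial x y z)) := by
  apply le_antisymm
  · exact iSup_le fun m => Submodule.span_mono (Set.image_subset_range _ _)
  · rw [Submodule.span_le]
    rintro _ ⟨e, rfl⟩
    exact Submodule.mem_iSup_of_mem (e.1 + e.2.1 + e.2.2) (Submodule.subset_span ⟨e, le_refl (e.1 + e.2.1 + e.2.2), rfl⟩)

/-- The left multiplications by `y` and `z` raise the filtration by ordered monomials in `x, y, z`
by at most one degree. -/
structure IsStraightened (K : Type*) [Field K] {A : Type*} [Ring A] [Algebra K A]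
    (x y z : A) : Prop where
  middle : ∀ m, ∀ v ∈ pbwFiltration K x y z m, y * v ∈ pbwFiltration K x y z (m + 1)
  right : ∀ m, ∀ v ∈ pbwFiltration K x y z m, z * v ∈ pbwFiltration K x y z (m + 1)

/-- Left multiplication by each letter of an ordered monomial raises the filtration by at most one,
so the filtration is multiplicative. -/
theorem IsStraightened.mul_mem (h : IsStraightened K x y z) {m n : ℕ} {u v : A}
    (hu : u ∈ pbwFiltration K x y z m) (hv : v ∈ pbwFiltration K x y z n) :
    u * v ∈ pbwFiltration K x y z (m + n) := by
  have hy : ∀ j m, ∀ v ∈ pbwFiltration K x y z m, y ^ j * v ∈ pbwFiltration K x y z (m + j) := by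
    intro j m v hv
    induction j with
    | zero => simpa using hv
    | succ j ih => rw [pow_succ', mul_assoc]; exact h.middle _ _ ih
  have hz : ∀ j m, ∀ v ∈ pbwFiltration K x y z m, z ^ j * v ∈ pbwFiltration K x y z (m + j) := by
    intro j m v hv
    induction j with
    | zero => simpa using hv
    | succ j ih => rw [pow_succ', mul_assoc]; exact h.right _ _ ih
  induction hu using Submodule.span_induction with
  | mem u hu =>
    obtain ⟨⟨i, j, k⟩, he, rfl⟩ := hu
    simp only [Set.mem_ofPred_eq] at he
    rw [pbwMonomial, mul_assoc, mul_assoc]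
    exact pbwFiltration_mono (by omega)
      (left_pow_mul_mem_pbwFiltration (hy j _ _ (hz k _ _ hv)) i)
  | zero => simp
  | add u v _ _ hu hv => rw [add_mul]; exact add_mem hu hv
  | smul c u _ hu => rw [smul_mul_assoc]; exact Submodule.smul_mem _ _ hu

theorem one_mem_pbwFiltration (m : ℕ) : (1 : A) ∈ pbwFiltration K x y z m := by
  simpa using pbwMonomial_mem (K := K) (x := x) (y := y) (z := z) 0 0 0 (Nat.zero_le m)

theorem IsStraightened.pow_le (h : IsStraightened K x y z) {W : Submodule K A} {d : ℕ}
    (hW : W ≤ pbwFiltration K x y z d) (i : ℕ) : W ^ i ≤ pbwFiltration K x y z (d * i) := by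
  induction i with
  | zero =>
    rw [pow_zero, Submodule.one_le]
    exact one_mem_pbwFiltration _
  | succ i ih =>
    rw [pow_succ, Nat.mul_succ, Submodule.mul_le]
    exact fun u hu v hv => h.mul_mem (ih hu) (hW hv)

theorem finite_setOf_sum_le (m : ℕ) : {e : ℕ × ℕ × ℕ | e.1 + e.2.1 + e.2.2 ≤ m}.Finite := by
  refine (Finset.finite_toSet
    (Finset.range (m + 1) ×ˢ Finset.range (m + 1) ×ˢ Finset.range (m + 1))).subset ?_
  rintro ⟨i, j, k⟩ h
  simp only [Set.mem_ofPred_eq] at h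
  simp only [Finset.coe_product, Set.mem_prod, Finset.mem_coe, Finset.mem_range]
  omega

instance (m : ℕ) : Module.Finite K (pbwFiltration K x y z m) :=
  Module.Finite.span_of_finite K ((finite_setOf_sum_le m).image _)

theorem finrank_pbwFiltration_le (m : ℕ) :
    finrank K (pbwFiltration K x y z m) ≤ (m + 1) ^ 3 := by
  classical
  let S := Finset.range (m + 1) ×ˢ Finset.range (m + 1) ×ˢ Finset.range (m + 1)
  have hS : pbwFiltration K x y z m ≤ Submodule.span K (S.image (pbwMonomial x y z)) := by
    refine Submodule.span_mono ?_
    rintro _ ⟨⟨i, j, k⟩, h, rfl⟩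
    simp only [Set.mem_ofPred_eq] at h
    refine Finset.mem_coe.2 (Finset.mem_image_of_mem _ ?_)
    simp only [S, Finset.mem_product, Finset.mem_range]
    omega
  calc _ ≤ finrank K (Submodule.span K (S.image (pbwMonomial x y z) : Set A)) :=
        Submodule.finrank_mono hS
    _ ≤ (S.image (pbwMonomial x y z)).card := finrank_span_finset_le_card _
    _ ≤ S.card := Finset.card_image_le
    _ = (m + 1) ^ 3 := by simp [S]; ring

/-- The cube of exponents at most m / 3 sits inside the simplex i + j + k ≤ m. Such crude bounds
suffice, since constant factors vanish after division by log n. -/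
theorem le_finrank_pbwFiltration (hli : LinearIndependent K (pbwMonomial x y z)) (m : ℕ) :
    (m / 3 + 1) ^ 3 ≤ finrank K (pbwFiltration K x y z m) := by
  let f : Fin (m / 3 + 1) × Fin (m / 3 + 1) × Fin (m / 3 + 1) → ℕ × ℕ × ℕ :=
    fun e => (e.1, e.2.1, e.2.2)
  have hf : Function.Injective f := by
    rintro ⟨i, j, k⟩ ⟨i', j', k'⟩ h
    simpa [f, Fin.ext_iff] using h
  have hmem : ∀ e, pbwMonomial x y z (f e) ∈ pbwFiltration K x y z m := by
    intro e
    refine pbwMonomial_mem _ _ _ ?_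
    simp only [f]
    omega
  have h2 : LinearIndependent K fun e => (⟨_, hmem e⟩ : pbwFiltration K x y z m) :=
    LinearIndependent.of_comp (pbwFiltration K x y z m).subtype (hli.comp f hf)
  have := h2.fintype_card_le_finrank
  simp only [Fintype.card_prod, Fintype.card_fin] at this
  linarith [show (m / 3 + 1) ^ 3 = (m / 3 + 1) * ((m / 3 + 1) * (m / 3 + 1)) by ring]

/-- The filtration is increasing and exhaustive, so finitely many generators lie in a common step.
-/
theorem exists_le_pbwFiltration (hsp : Submodule.span K (Set.range (pbwMonomial x y z)) = ⊤)
    {W : Submodule K A} (hW : W.FG) : ∃ d, W ≤ pbwFiltration K x y z d := by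
  have hdir : Directed (· ≤ ·) (pbwFiltration K x y z) :=
    Monotone.directed_le fun _ _ => pbwFiltration_mono
  obtain ⟨s, rfl⟩ := hW
  have hmem : ∀ v : A, ∃ d, v ∈ pbwFiltration K x y z d := fun v => by
    rw [← Submodule.mem_iSup_of_directed _ hdir, iSup_pbwFiltration, hsp]
    trivial
  choose d hd using hmem
  refine ⟨s.sup d, Submodule.span_le.2 fun v hv => ?_⟩
  exact pbwFiltration_mono (Finset.le_sup hv) (hd v)

theorem tendsto_log_ratio (c : ℝ) :
    Tendsto (fun n : ℕ => ((3 + c / Real.log n : ℝ) : EReal)) atTop (nhds 3) := by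
  have h := (((Real.tendsto_log_atTop.comp tendsto_natCast_atTop_atTop).const_div_atTop c).const_add
    (3 : ℝ))
  rw [add_zero] at h
  exact (continuous_coe_real_ereal.tendsto 3).comp h

theorem log_div_log_le {d n N : ℕ} (hn : 2 ≤ n) (hN : N ≤ (d * n + 1) ^ 3) :
    Real.log N / Real.log n ≤ 3 + 3 * Real.log (d + 1) / Real.log n := by
  have hlog : 0 < Real.log n := Real.log_pos (by exact_mod_cast hn)
  rw [div_le_iff₀ hlog, add_mul, div_mul_cancel₀ _ hlog.ne']
  rcases Nat.eq_zero_or_pos N with rfl | hpos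
  · have : 0 ≤ Real.log ((d + 1 : ℕ) : ℝ) := Real.log_natCast_nonneg _
    push_cast at this
    simp only [Nat.cast_zero, Real.log_zero]
    positivity
  · have h1 : (N : ℝ) ≤ (((d : ℝ) + 1) * n) ^ 3 := by
      have h2 : d * n + 1 ≤ (d + 1) * n := by rw [add_mul]; omega
      exact_mod_cast hN.trans (Nat.pow_le_pow_left h2 3)
    calc Real.log N ≤ Real.log ((((d : ℝ) + 1) * n) ^ 3) :=
          Real.log_le_log (by exact_mod_cast hpos) h1
      _ = _ := by
        rw [Real.log_pow, Real.log_mul (by positivity) (by positivity)]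
        push_cast
        ring

theorem le_log_div_log {n N : ℕ} (hn : 2 ≤ n) (hN : (n / 3 + 1) ^ 3 ≤ N) :
    3 + (-(3 * Real.log 3)) / Real.log n ≤ Real.log N / Real.log n := by
  have hlog : 0 < Real.log n := Real.log_pos (by exact_mod_cast hn)
  have hn0 : (0 : ℝ) < n := by positivity
  rw [le_div_iff₀ hlog, add_mul, div_mul_cancel₀ _ hlog.ne']
  have h1 : ((n : ℝ) / 3) ^ 3 ≤ (N : ℝ) := by
    have h2 : (n : ℝ) / 3 ≤ (n / 3 + 1 : ℕ) := by
      have h3 : n ≤ 3 * (n / 3 + 1) := by omega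
      have h4 : (n : ℝ) ≤ 3 * (n / 3 + 1 : ℕ) := by exact_mod_cast h3
      linarith
    calc ((n : ℝ) / 3) ^ 3 ≤ ((n / 3 + 1 : ℕ) : ℝ) ^ 3 := by gcongr
      _ ≤ (N : ℝ) := by exact_mod_cast hN
  calc _ = Real.log (((n : ℝ) / 3) ^ 3) := by
        rw [Real.log_pow, Real.log_div hn0.ne' (by norm_num)]
        push_cast
        ring
    _ ≤ _ := Real.log_le_log (by positivity) h1

/-- An algebra with a PBW basis on three generators has Gelfand–Kirillov dimension `3`. -/
theorem IsStraightened.GKdim_eq_three (h : IsStraightened K x y z)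
    (hli : LinearIndependent K (pbwMonomial x y z))
    (hsp : Submodule.span K (Set.range (pbwMonomial x y z)) = ⊤) : GKdim K A = 3 := by
  apply le_antisymm
  · refine iSup_le fun ⟨W, hW⟩ => ?_
    obtain ⟨d, hd⟩ := exists_le_pbwFiltration hsp hW
    rw [← (tendsto_log_ratio (3 * Real.log (d + 1))).limsup_eq]
    refine limsup_le_limsup ?_
    filter_upwards [eventually_ge_atTop 2] with n hn
    refine EReal.coe_le_coe_iff.2 (log_div_log_le hn (le_trans ?_ (finrank_pbwFiltration_le
      (K := K) (x := x) (y := y) (z := z) (d * n))))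
    refine Submodule.finrank_mono (iSup_le fun i => (h.pow_le hd i).trans (pbwFiltration_mono ?_))
    exact Nat.mul_le_mul_left d (by omega)
  -- The lower bound is attained on the span of the generators: its powers up to n contain all
  -- ordered monomials of degree at most n, with 1 coming from W^0.
  · let W : Submodule K A := Submodule.span K {x, y, z}
    have hWfg : W.FG := Submodule.fg_span (by simp)
    have hx : x ∈ W := Submodule.subset_span (by simp)
    have hy : y ∈ W := Submodule.subset_span (by simp)
    have hz : z ∈ W := Submodule.subset_span (by simp)
    have hWle : W ≤ pbwFiltration K x y z 1 := by
      rw [Submodule.span_le]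
      refine Set.insert_subset ?_ (Set.insert_subset ?_ (Set.singleton_subset_iff.2 ?_))
      · simpa using pbwMonomial_mem (K := K) (x := x) (y := y) (z := z) 1 0 0 le_rfl
      · simpa using pbwMonomial_mem (K := K) (x := x) (y := y) (z := z) 0 1 0 le_rfl
      · simpa using pbwMonomial_mem (K := K) (x := x) (y := y) (z := z) 0 0 1 le_rfl
    refine le_trans ?_ (le_iSup _ (⟨W, hWfg⟩ : {W : Submodule K A // W.FG}))
    rw [← (tendsto_log_ratio (-(3 * Real.log 3))).limsup_eq]
    refine limsup_le_limsup ?_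
    filter_upwards [eventually_ge_atTop 2] with n hn
    refine EReal.coe_le_coe_iff.2 (le_log_div_log hn
      ((le_finrank_pbwFiltration hli n).trans ?_))
    have hfin : (⨆ i : Fin (n + 1), W ^ (i : ℕ)) ≤ pbwFiltration K x y z n :=
      iSup_le fun i => (h.pow_le hWle i).trans (pbwFiltration_mono (by omega))
    -- `finrank` is monotone only into a finite-dimensional space, since it is 0 on
    -- infinite-dimensional ones.
    have := Submodule.finiteDimensional_of_le hfin
    refine Submodule.finrank_mono (Submodule.span_le.2 ?_)
    rintro _ ⟨⟨i, j, k⟩, he, rfl⟩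
    simp only [Set.mem_ofPred_eq] at he
    refine Submodule.mem_iSup_of_mem (⟨i + j + k, by omega⟩ : Fin (n + 1)) ?_
    rw [pow_add, pow_add]
    exact Submodule.mul_mem_mul (Submodule.mul_mem_mul (Submodule.pow_mem_pow _ hx _)
      (Submodule.pow_mem_pow _ hy _)) (Submodule.pow_mem_pow _ hz _)

end Filtration

/-! ### The PBW basis for t = 1 -/

section PositiveCase

variable {K : Type*} [Field K]

/-- A family whose matrix is unitriangular with respect to a height function is linearly
independent. -/
theorem linearIndependent_of_unitriangular {ι : Type*} {f : ι → ι →₀ K} (ht : ι → ℕ)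
    (hf : ∀ i j, ht j ≤ ht i → f i j = Finsupp.single i 1 j) : LinearIndependent K f := by
  classical
  rw [linearIndependent_iff]
  intro l hl
  by_contra hne
  -- At an index j of least height in the support, every other f i has coefficient 0, so the
  -- relation reduces to l j = 0.
  obtain ⟨j, hj, hmin⟩ :=
    Finset.exists_min_image l.support ht (Finsupp.support_nonempty_iff.2 hne)
  have h := DFunLike.congr_fun hl j
  rw [Finsupp.linearCombination_apply, Finsupp.sum, Finsupp.finsetSum_apply,
    Finset.sum_eq_single_of_mem j hj] at h
  · rw [Finsupp.smul_apply, hf j j le_rfl, Finsupp.single_eq_same, smul_eq_mul, mul_one] at h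
    exact Finsupp.mem_support_iff.1 hj h
  · intro i hi hij
    rw [Finsupp.smul_apply, hf i j (hmin i hi), Finsupp.single_eq_of_ne (Ne.symm hij), smul_zero]

/-- The vector `X^i Y^j Z^k` of the polynomial representation. -/
def vec (K : Type*) [Field K] (i j k : ℕ) : ℕ × ℕ × ℕ →₀ K := Finsupp.single (i, j, k) 1

/-- The action of `x_1` for `t = 1` on polynomials: multiplication by `X`. -/
def posOp₁ (K : Type*) [Field K] : End K (ℕ × ℕ × ℕ →₀ K) :=
  Finsupp.linearCombination K fun e => vec K (e.1 + 1) e.2.1 e.2.2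

/-- The action of `x_2` on polynomials: `Y + a X (X ∂_X + Y ∂_Y + Z ∂_Z)`. -/
def posOp₂ (a : K) : End K (ℕ × ℕ × ℕ →₀ K) :=
  Finsupp.linearCombination K fun e => vec K e.1 (e.2.1 + 1) e.2.2 +
    (a * (e.1 + e.2.1 + e.2.2)) • vec K (e.1 + 1) e.2.1 e.2.2

/-- The action of `x_3` on polynomials: `Z + p X (X ∂_X + Y ∂_Y) - (k + p a) X² ∂_Y`. -/
def posOp₃ (a k p : K) : End K (ℕ × ℕ × ℕ →₀ K) :=
  Finsupp.linearCombination K fun e => vec K e.1 e.2.1 (e.2.2 + 1) +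
    (p * (e.1 + e.2.1)) • vec K (e.1 + 1) e.2.1 e.2.2 -
    ((k + p * a) * e.2.1) • vec K (e.1 + 2) (e.2.1 - 1) e.2.2

variable (a b k p q : K)

theorem posOp₁_vec (i j l : ℕ) : posOp₁ K (vec K i j l) = vec K (i + 1) j l := by
  simp [posOp₁, vec, Finsupp.linearCombination_single]

theorem posOp₂_vec (i j l : ℕ) : posOp₂ a (vec K i j l) =
    vec K i (j + 1) l + (a * (i + j + l)) • vec K (i + 1) j l := by
  rw [posOp₂, vec, Finsupp.linearCombination_single, one_smul]

theorem posOp₃_vec (i j l : ℕ) : posOp₃ a k p (vec K i j l) =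
    vec K i j (l + 1) + (p * (i + j)) • vec K (i + 1) j l -
      ((k + p * a) * j) • vec K (i + 2) (j - 1) l := by
  rw [posOp₃, vec, Finsupp.linearCombination_single, one_smul]

theorem end_ext_vec {f g : End K (ℕ × ℕ × ℕ →₀ K)}
    (h : ∀ i j l, f (vec K i j l) = g (vec K i j l)) : f = g :=
  Finsupp.lhom_ext' fun e => LinearMap.ext_ring (h e.1 e.2.1 e.2.2)

/-- With E = X∂_X + Y∂_Y + Z∂_Z and E' = X∂_X + Y∂_Y, which commute and satisfy [E, X] = [E', X] =
X, the relations become identities between differential operators. Every correction term carries a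
factor X, which is what gives unitriangularity below. -/
theorem lift_posOp_relationsPos :
    ∀ s ∈ relationsPos a k p,
      FreeAlgebra.lift K ![posOp₁ K, posOp₂ a, posOp₃ a k p] s = 0 := by
  simp only [relationsPos, x₁, x₂, x₃, pow_two, Set.mem_insert_iff, Set.mem_singleton_iff]
  rintro s (rfl | rfl | rfl) <;>
    simp only [map_add, map_sub, map_smul, map_mul, FreeAlgebra.lift_ι_apply] <;>
    refine end_ext_vec fun i j l => ?_
  · simp [posOp₁_vec, posOp₂_vec]
    module
  · simp [posOp₁_vec, posOp₃_vec]
    module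
  -- The exponent `j - 1` is truncated at j = 0, where its coefficient vanishes.
  · cases j with
    | zero =>
      simp [posOp₁_vec, posOp₂_vec, posOp₃_vec]
      module
    | succ j =>
      simp [posOp₁_vec, posOp₂_vec, posOp₃_vec]
      module

/-- The polynomials divisible by `X^m`. -/
def xAdic (K : Type*) [Field K] (m : ℕ) : Submodule K (ℕ × ℕ × ℕ →₀ K) :=
  Finsupp.supported K K {e | m ≤ e.1}

theorem vec_mem_xAdic {m i : ℕ} (j l : ℕ) (h : m ≤ i) : vec K i j l ∈ xAdic K m :=
  Finsupp.single_mem_supported K 1 h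

theorem map_mem_xAdic {f : End K (ℕ × ℕ × ℕ →₀ K)} {m n : ℕ}
    (h : ∀ i j l, m ≤ i → f (vec K i j l) ∈ xAdic K n) {v : ℕ × ℕ × ℕ →₀ K}
    (hv : v ∈ xAdic K m) : f v ∈ xAdic K n := by
  rw [xAdic, Finsupp.supported_eq_span_single] at hv
  induction hv using Submodule.span_induction with
  | mem v hv => obtain ⟨e, he, rfl⟩ := hv; exact h e.1 e.2.1 e.2.2 he
  | zero => simp
  | add u v _ _ hu hv => rw [map_add]; exact add_mem hu hv
  | smul c u _ hu => rw [map_smul]; exact Submodule.smul_mem _ _ hu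

theorem posOp₁_pow_mem {m : ℕ} (i : ℕ) {v : ℕ × ℕ × ℕ →₀ K} (hv : v ∈ xAdic K m) :
    (posOp₁ K ^ i) v ∈ xAdic K (m + i) := by
  induction i with
  | zero => simpa using hv
  | succ i ih =>
    rw [pow_succ', Module.End.mul_apply]
    refine map_mem_xAdic (fun i' j l h => ?_) ih
    rw [posOp₁_vec]
    exact vec_mem_xAdic _ _ (by omega)

theorem posOp₂_mem {m : ℕ} {v : ℕ × ℕ × ℕ →₀ K} (hv : v ∈ xAdic K m) :
    posOp₂ a v ∈ xAdic K m := by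
  refine map_mem_xAdic (fun i j l h => ?_) hv
  rw [posOp₂_vec]
  exact add_mem (vec_mem_xAdic _ _ h) (Submodule.smul_mem _ _ (vec_mem_xAdic _ _ (by omega)))

theorem posOp₁_pow_vec (i j l m : ℕ) :
    (posOp₁ K ^ i) (vec K m j l) = vec K (m + i) j l := by
  induction i with
  | zero => simp
  | succ i ih => rw [pow_succ', Module.End.mul_apply, ih, posOp₁_vec]; rfl

/-- The corrections in x_3 involve only ∂_X and ∂_Y, so they vanish on powers of Z. -/
theorem posOp₃_pow_vec (l : ℕ) : (posOp₃ a k p ^ l) (vec K 0 0 0) = vec K 0 0 l := by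
  induction l with
  | zero => simp
  | succ l ih => rw [pow_succ', Module.End.mul_apply, ih, posOp₃_vec]; simp

theorem posOp₂_pow_vec (j l : ℕ) :
    (posOp₂ a ^ j) (vec K 0 0 l) - vec K 0 j l ∈ xAdic K 1 := by
  induction j with
  | zero => simp
  | succ j ih =>
    have := add_mem (posOp₂_mem a ih)
      (Submodule.smul_mem _ (a * (0 + j + l)) (vec_mem_xAdic (K := K) (m := 1) (i := 1) j l le_rfl))
    convert this using 1
    rw [pow_succ', Module.End.mul_apply, map_sub, posOp₂_vec]
    simp
    abel

/-- The ordered monomials act on `1` in a unitriangular way. -/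
theorem posOp_monomial_vec (e : ℕ × ℕ × ℕ) :
    (posOp₁ K ^ e.1 * posOp₂ a ^ e.2.1 * posOp₃ a k p ^ e.2.2) (vec K 0 0 0) -
      Finsupp.single e 1 ∈ xAdic K (e.1 + 1) := by
  have := posOp₁_pow_mem e.1 (posOp₂_pow_vec a e.2.1 e.2.2)
  rw [map_sub, posOp₁_pow_vec, zero_add, add_comm 1] at this
  rwa [Module.End.mul_apply, Module.End.mul_apply, posOp₃_pow_vec]

theorem linearIndependent_pbwMonomial [CharZero K] :
    LinearIndependent K (pbwMonomial (gen (braidingR16 1 a b k p q) 0)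
      (gen (braidingR16 1 a b k p q) 1) (gen (braidingR16 1 a b k p q) 2)) := by
  obtain ⟨ψ, hψ⟩ := exists_algHom_of_relations (B := End K (ℕ × ℕ × ℕ →₀ K))
    (nicholsIdeal_R16_pos a b k p q) ![posOp₁ K, posOp₂ a, posOp₃ a k p] (lift_posOp_relationsPos a k p)
  let ev : NicholsAlgebra (braidingR16 1 a b k p q) →ₗ[K] ℕ × ℕ × ℕ →₀ K :=
    LinearMap.applyₗ (vec K 0 0 0) ∘ₗ ψ.toLinearMap
  refine LinearIndependent.of_comp ev
    (linearIndependent_of_unitriangular (fun e => e.1) fun e e' h => ?_)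
  have h1 := posOp_monomial_vec a k p e
  have h2 : (ev ∘ pbwMonomial (gen (braidingR16 1 a b k p q) 0)
      (gen (braidingR16 1 a b k p q) 1) (gen (braidingR16 1 a b k p q) 2)) e =
      (posOp₁ K ^ e.1 * posOp₂ a ^ e.2.1 * posOp₃ a k p ^ e.2.2) (vec K 0 0 0) := by
    simp [ev, pbwMonomial, hψ]
  rw [h2, ← sub_eq_zero, ← Finsupp.sub_apply]
  by_contra hne
  -- A nonzero entry off the leading term has X-degree above `e.1`, contrary to `h`.
  have : e.1 + 1 ≤ e'.1 := (Finsupp.mem_supported K _).1 h1 (Finsupp.mem_support_iff.2 hne)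
  omega

theorem isStraightened_R16 [CharZero K] :
    IsStraightened K (gen (braidingR16 1 a b k p q) 0)
      (gen (braidingR16 1 a b k p q) 1) (gen (braidingR16 1 a b k p q) 2) := by
  have h : ∀ s ∈ relationsPos a k p, projection (braidingR16 1 a b k p q) s = 0 :=
    fun s hs => projection_relation (nicholsIdeal_R16_pos a b k p q) hs
  simp only [relationsPos, Set.forall_mem_insert, Set.mem_singleton_iff, forall_eq, x₁, x₂, x₃,
    map_add, map_sub, map_smul, map_mul, projection_ι, pow_two] at h
  obtain ⟨h1, h2, h3⟩ := h
  have hyx := sub_eq_zero.1 ((sub_sub _ _ _).symm.trans h1)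
  have hzx := sub_eq_zero.1 ((sub_sub _ _ _).symm.trans h2)
  refine ⟨fun m v hv => middle_mul_mem_pbwFiltration hyx hv,
    fun m v hv => right_mul_mem_pbwFiltration (c := k + p * a) hyx hzx ?_ hv⟩
  rw [← sub_eq_zero, ← h3]
  abel

theorem span_pbwMonomial [CharZero K] :
    Submodule.span K (Set.range (pbwMonomial (gen (braidingR16 1 a b k p q) 0)
      (gen (braidingR16 1 a b k p q) 1) (gen (braidingR16 1 a b k p q) 2))) = ⊤ := by
  have hs := isStraightened_R16 a b k p q
  rw [← iSup_pbwFiltration]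
  have hdir : Directed (· ≤ ·) (pbwFiltration K (gen (braidingR16 1 a b k p q) 0)
      (gen (braidingR16 1 a b k p q) 1) (gen (braidingR16 1 a b k p q) 2)) :=
    Monotone.directed_le fun _ _ => pbwFiltration_mono
  refine submodule_eq_top_of_gen_mul_mem
    (Submodule.mem_iSup_of_mem 0 (one_mem_pbwFiltration 0)) fun i v hv => ?_
  obtain ⟨m, hm⟩ := (Submodule.mem_iSup_of_directed _ hdir).1 hv
  refine Submodule.mem_iSup_of_mem (m + 1) ?_
  fin_cases i
  · exact left_mul_mem_pbwFiltration hm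
  · exact hs.middle m v hm
  · exact hs.right m v hm

end PositiveCase

end NicholsR16
end

open NicholsR16 in
theorem proposition3p12 {K : Type*} [Field K] [IsAlgClosed K] [CharZero K]
    (t a b k p q : K) (ht : t ≠ 0) :
    -- if `t² ≠ 1`, there are no quadratic relations
    (t ^ 2 ≠ 1 → nicholsRelations (braidingR16 t a b k p q) 2 = ⊥) ∧
    -- `t = -1`
    (t = -1 →
      (nicholsSubspace (braidingR16 t a b k p q) : Set (FreeAlgebra K (Fin 3))) =
          TwoSidedIdeal.span (relationsNeg a b p q) ∧
      (∃ B : Module.Basis (Fin 2 × Fin 2 × Fin 2) K (NicholsAlgebra (braidingR16 t a b k p q)),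
        ∀ e, B e = gen (braidingR16 t a b k p q) 0 ^ (e.1 : ℕ) *
          gen (braidingR16 t a b k p q) 1 ^ (e.2.1 : ℕ) *
          gen (braidingR16 t a b k p q) 2 ^ (e.2.2 : ℕ)) ∧
      Module.finrank K (NicholsAlgebra (braidingR16 t a b k p q)) = 8 ∧
      GKdim K (NicholsAlgebra (braidingR16 t a b k p q)) = 0) ∧
    -- `t = 1`
    (t = 1 →
      (nicholsSubspace (braidingR16 t a b k p q) : Set (FreeAlgebra K (Fin 3))) =
          TwoSidedIdeal.span (relationsPos a k p) ∧
      (∃ B : Module.Basis (ℕ × ℕ × ℕ) K (NicholsAlgebra (braidingR16 t a b k p q)),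
        ∀ e, B e = gen (braidingR16 t a b k p q) 0 ^ e.1 *
          gen (braidingR16 t a b k p q) 1 ^ e.2.1 *
          gen (braidingR16 t a b k p q) 2 ^ e.2.2) ∧
      GKdim K (NicholsAlgebra (braidingR16 t a b k p q)) = 3) := by
  refine ⟨nicholsRelations_two_eq_bot t a b k p q, ?_, ?_⟩
  · rintro rfl
    let B := basisNeg a b k p q
    have hfin : Module.Finite K (NicholsAlgebra (braidingR16 (-1) a b k p q)) :=
      Module.Finite.of_basis B
    exact ⟨nicholsSubspace_R16_neg a b k p q, ⟨B, fun e => Module.Basis.mk_apply _ _ e⟩,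
      (Module.finrank_eq_card_basis B).trans (by simp), GKdim_eq_zero_of_finite⟩
  · rintro rfl
    have hli := linearIndependent_pbwMonomial a b k p q
    have hsp := span_pbwMonomial a b k p q
    exact ⟨nicholsSubspace_R16_pos a b k p q,
      ⟨Module.Basis.mk hli hsp.ge, fun e => Module.Basis.mk_apply _ _ e⟩,
      (isStraightened_R16 a b k p q).GKdim_eq_three hli hsp⟩
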